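/- Write $e(x)=\exp(2\pi i x)$. Let $q$ be a prime number and let $f:\mathbb{N}\to\{z\in\mathbb{C}:|z|=1\}$ be strongly $q$-multiplicative, i.e. $f(aq+b)=f(a)f(b)$ for all integers $a\ge 0$ and $0\le b<q$, and proper, i.e. not of the form $f(n)=e(\gamma n)$ with $\gamma\in\mathbb{R}$, $(q-1)\gamma\in\mathbb{Z}$. Put $F_1(t)=\frac1q\sum_{0\le u<q}f(u)\,e(-tu/q)$, $$c(f)=\frac{-\log\left(\max_{t\in\mathbb{R}}|F_1(t)F_1(qt)|\right)}{2\log q},\qquad \eta(f)=\frac{1}{\log q}\log\left(\max_{0\le t\le 1}\sum_{0\le r<q}|F_1(qt+r)|\right),$$ and assume that $\eta(f)\le 1/2000$. Let $C>0$. Then there is a constant $K>0$, depending only on $q$, $f$ and $C$, such that for all integers $\mu,\nu\ge 0$ with $\mu\le\frac14\nu+C$, all $\theta\in\mathbb{R}$, and all families of intervals $I_\nu(m)\subseteq[q^{\nu-1},q^\nu)$ $(q^{\mu-1}\le m<q^\mu)$, the sum $$S_I(\theta)=\sum_{q^{\mu-1}\le m<q^\mu}\Bigl|\sum_{n\in I_\nu(m)}f(m^2n^2)\,e(\theta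 mn)\Bigr|$$ (with $m$, $n$ running over integers) satisfies $$q^{-\mu-\nu}\,|S_I(\theta)|\le K\,\nu^{1/2}\,q^{-\frac{10}{51}c(f)\nu}.$$ -/

import Mathlib

namespace SquareDigits

noncomputable section

/-- The additive character `e(x) = exp(2πix)`. -/
def e (x : ℝ) : ℂ := Complex.exp (2 * Real.pi * Complex.I * (x : ℂ))

/-- Strongly `q`-multiplicative functions, with values of modulus one. -/
structure IsStronglyQMultiplicative (q : ℕ) (f : ℕ → ℂ) : Prop where
  norm_eq_one : ∀ n, ‖f n‖ = 1
  map_mul_add : ∀ a b : ℕ, b < q → f (a * q + b) = f a * f b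

/-- A strongly `q`-multiplicative function is proper if it is not of the form
`n ↦ e(γn)` with `(q - 1)γ ∈ ℤ`. -/
structure IsProper (q : ℕ) (f : ℕ → ℂ) : Prop extends IsStronglyQMultiplicative q f where
  ne_character : ¬ ∃ γ : ℝ, (∃ k : ℤ, ((q : ℝ) - 1) * γ = k) ∧ ∀ n : ℕ, f n = e (γ * n)

/-- The Fourier transform `F_L(t) = q^{-L} ∑_{0 ≤ u < q^L} f(u) e(-tu/q^L)`. -/
def F (q : ℕ) (f : ℕ → ℂ) (L : ℕ) (t : ℝ) : ℂ :=
  1 / (q : ℂ) ^ L * ∑ u ∈ Finset.range (q ^ L), f u * e (-t * u / (q : ℝ) ^ L)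

/-- `c(f) = -log (max_{t ∈ ℝ} |F_1(t) F_1(qt)|) / (2 log q)`.
The function of `t` is continuous, bounded and periodic, so the supremum is a maximum. -/
def c (q : ℕ) (f : ℕ → ℂ) : ℝ :=
  -Real.log (⨆ t : ℝ, ‖F q f 1 t * F q f 1 (q * t)‖) / (2 * Real.log q)

/-- `η(f) = log (max_{0 ≤ t ≤ 1} ∑_{0 ≤ r < q} |F_1(qt + r)|) / log q`.
The function of `t` is continuous, so the supremum over `[0, 1]` is a maximum. -/
def η (q : ℕ) (f : ℕ → ℂ) : ℝ :=
  1 / Real.log q *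
    Real.log (⨆ t : Set.Icc (0 : ℝ) 1, ∑ r ∈ Finset.range q, ‖F q f 1 (q * t + r)‖)

open Classical in
/-- The type I sum
`S_I(θ) = ∑_{q^{μ-1} ≤ m < q^μ} |∑_{n ∈ I(m)} f(m²n²) e(θmn)|`,
for sets `I(m) ⊆ [q^{ν-1}, q^ν)` of real numbers; `n` runs through the integers in `I(m)`.
For `μ = 0` or `ν = 0` the truncated exponent is harmless: both `[q^{-1}, 1)` and `[1, 1)`
contain no integer. -/
def typeISum (q : ℕ) (f : ℕ → ℂ) (μ ν : ℕ) (I : ℕ → Set ℝ) (θ : ℝ) : ℝ :=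
  ∑ m ∈ Finset.Ico (q ^ (μ - 1)) (q ^ μ),
    ‖∑ n ∈ (Finset.Ico (q ^ (ν - 1)) (q ^ ν)).filter (fun n : ℕ => (n : ℝ) ∈ I m),
      f (m ^ 2 * n ^ 2) * e (θ * m * n)‖

end

end SquareDigits

namespace SquareDigits

open Finset

/-! ### The additive character -/

/-! Each `m` is treated separately, and the sum over `n` must save `q^{-(10/51) c ν}`. If `c ≤ 0`,
the trivial bound suffices. Otherwise powers of `q` are removed from `m`, since `f` ignores trailing
zeros, so that `q ∤ m`. Van der Corput's inequality with `q^ρ` shifts, `ρ = ⌊ν/100⌋`, cancels the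
linear twist and leaves the correlations of `f(m²(n+r)²)` with `f(m²n²)`; their saving is halved by
the square root.

A shift by `r` rarely changes the digits of `m²n²` above position `Λ = 2μ + ν + 2ρ`, so `f` may be
truncated to its lowest `Λ` digits (`norm_sum_sub_sum_mod_le`). Fourier inversion then gives a sum
over frequencies `h, k` modulo `q^Λ` of `|F(h)| |F(k)|` times a quadratic exponential sum with
leading coefficient `(h-k)m²/q^Λ`. The `L¹` norm of `F` is at most `q^{ηΛ}`, so a fixed power saving
in the exponential sum outweighs it. There are three cases (`norm_pairSum_le_add`). If that
coefficient has denominator at least `q^ρ`, Weyl's bound saves `q^{-ρ/2}`, up to an error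
`q^{11Λ/20}`. If the denominator is smaller, a shift of `n` by `q^ρ` multiplies the summand by a
constant `e(2hm²r/q^{Λ-ρ})`; if this is not near 1, the sum is short. If it is near 1, `2hm²r` is
close to a multiple of `q^{Λ-ρ}`. Such `h` carry `L²` mass at most `q^{2c(1-σ)}`, `σ = ν - 3ρ`
(`sum_sq_norm_F_near_multiple_le`), and Weyl's saving for smaller denominators pays for the sum over
`k` (`sum_sum_modEq_le`).

Only the last case has a saving governed by `c`; the others gain a fixed power of `q^ν`, which is
enough because `c ≤ η ≤ 1/2000` (`c_le_eta`). -/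

lemma e_zero : e 0 = 1 := by simp [e]

lemma e_add (x y : ℝ) : e (x + y) = e x * e y := by
  simp only [e, ← Complex.exp_add]
  push_cast
  ring_nf

lemma norm_e (x : ℝ) : ‖e x‖ = 1 := by
  have h : 2 * (Real.pi : ℂ) * Complex.I * (x : ℂ) = ((2 * Real.pi * x : ℝ) : ℂ) * Complex.I := by
    push_cast
    ring
  rw [e, h, Complex.norm_exp_ofReal_mul_I]

lemma conj_e (x : ℝ) : (starRingEnd ℂ) (e x) = e (-x) := by
  rw [e, e, ← Complex.exp_conj]
  simp only [map_mul, Complex.conj_ofReal, Complex.conj_I, map_ofNat]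
  push_cast
  ring_nf

lemma e_intCast (k : ℤ) : e k = 1 := by
  rw [e, Complex.exp_eq_one_iff]
  exact ⟨k, by push_cast; ring⟩

lemma e_add_intCast (x : ℝ) (k : ℤ) : e (x + k) = e x := by
  rw [e_add, e_intCast, mul_one]

lemma e_eq_of_sub_eq_intCast {x y : ℝ} (k : ℤ) (h : x - y = k) : e x = e y := by
  rw [← e_add_intCast y k, ← h]
  ring_nf

lemma e_natCast_mul (n : ℕ) (x : ℝ) : e (n * x) = e x ^ n := by
  rw [e, e, ← Complex.exp_nat_mul]
  push_cast
  ring_nf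

lemma norm_one_sub_e (x : ℝ) : ‖1 - e x‖ = 2 * |Real.sin (Real.pi * x)| := by
  have h : e x = Complex.exp (Complex.I * ((2 * Real.pi * x : ℝ) : ℂ)) := by
    rw [e]
    push_cast
    ring_nf
  rw [norm_sub_rev, h, Complex.norm_exp_I_mul_ofReal_sub_one, norm_mul, Real.norm_eq_abs,
    Real.norm_eq_abs, abs_two]
  ring_nf

lemma two_mul_le_sin_pi_mul {x : ℝ} (h0 : 0 ≤ x) (h1 : x ≤ 1 / 2) :
    2 * x ≤ Real.sin (Real.pi * x) := by
  have h := Real.mul_le_sin (x := Real.pi * x) (by positivity) (by nlinarith [Real.pi_pos])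
  have h2 : 2 / Real.pi * (Real.pi * x) = 2 * x := by
    field_simp
  linarith

/-- `|1 - e(x)| ≥ 4 ‖x‖`. -/
lemma exists_int_four_mul_abs_sub_le (x : ℝ) : ∃ y : ℤ, 4 * |x - y| ≤ ‖1 - e x‖ := by
  refine ⟨round x, ?_⟩
  have h1 : ‖1 - e x‖ = ‖1 - e (x - round x)‖ := by
    rw [e_eq_of_sub_eq_intCast (x := x) (y := x - round x) (round x) (by ring)]
  have h2 := abs_sub_round x
  rw [h1, norm_one_sub_e]
  generalize x - round x = t at *
  have h3 : |Real.sin (Real.pi * t)| = |Real.sin (Real.pi * |t|)| := by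
    rcases abs_choice t with h | h <;> rw [h]
    rw [mul_neg, Real.sin_neg, abs_neg]
  rw [h3]
  have h4 := two_mul_le_sin_pi_mul (abs_nonneg t) h2
  have h5 := le_abs_self (Real.sin (Real.pi * |t|))
  linarith

lemma sum_e_div_eq_ite {Q : ℕ} (hQ : 0 < Q) (k : ℤ) :
    ∑ h ∈ range Q, e (h * (k / Q)) = if (Q : ℤ) ∣ k then (Q : ℂ) else 0 := by
  have hQ' : (Q : ℝ) ≠ 0 := by positivity
  split_ifs with hk
  · obtain ⟨a, rfl⟩ := hk
    have h : ∀ h ∈ range Q, e (h * (((Q * a : ℤ) : ℝ) / Q)) = 1 := by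
      intro h _
      rw [← e_intCast (h * a)]
      congr 1
      push_cast
      field_simp
    rw [sum_congr rfl h]
    simp
  · have h1 : e (k / Q) ≠ 1 := by
      intro h1
      rw [e, Complex.exp_eq_one_iff] at h1
      obtain ⟨n, hn⟩ := h1
      have h2 : ((k : ℝ) / Q : ℂ) = n := by
        have h3 : (2 * Real.pi * Complex.I : ℂ) ≠ 0 := by
          simp [Real.pi_ne_zero]
        apply mul_left_cancel₀ h3
        rw [← mul_comm (n : ℂ), ← hn]
        push_cast
        ring
      have h3 : (k : ℝ) / Q = n := by exact_mod_cast h2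
      rw [div_eq_iff hQ'] at h3
      exact hk ⟨n, by exact_mod_cast (by rw [h3]; ring : (k : ℝ) = Q * n)⟩
    simp only [e_natCast_mul]
    rw [geom_sum_eq h1, ← e_natCast_mul, mul_div_cancel₀ _ hQ', e_intCast]
    simp

/-! ### Strongly multiplicative functions and their Fourier transforms -/

namespace IsStronglyQMultiplicative

variable {q : ℕ} {f : ℕ → ℂ}

lemma map_zero (hf : IsStronglyQMultiplicative q f) (hq : 0 < q) : f 0 = 1 := by
  have h := hf.map_mul_add 0 0 hq
  have h0 : f 0 ≠ 0 := by
    intro h0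
    have := hf.norm_eq_one 0
    simp [h0] at this
  simp only [zero_mul, add_zero] at h
  exact mul_left_cancel₀ h0 (by rw [← h, mul_one])

lemma map_mul_pow_add (hf : IsStronglyQMultiplicative q f) (hq : 0 < q) (k a b : ℕ)
    (hb : b < q ^ k) : f (a * q ^ k + b) = f a * f b := by
  induction k generalizing b with
  | zero =>
    have : b = 0 := by simpa using hb
    subst this
    simp [hf.map_zero hq]
  | succ k ih =>
    have h1 : a * q ^ (k + 1) + b = (a * q ^ k + b / q) * q + b % q := by
      have := Nat.div_add_mod b q
      rw [pow_succ]
      nlinarith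
    have h2 : b / q < q ^ k := by
      rw [Nat.div_lt_iff_lt_mul hq]
      rwa [pow_succ] at hb
    have h3 := hf.map_mul_add (b / q) (b % q) (Nat.mod_lt _ hq)
    rw [h1, hf.map_mul_add _ _ (Nat.mod_lt _ hq), ih _ h2, mul_assoc, ← h3, mul_comm (b / q),
      Nat.div_add_mod]

lemma map_mul_pow (hf : IsStronglyQMultiplicative q f) (hq : 0 < q) (k a : ℕ) :
    f (a * q ^ k) = f a := by
  have h := hf.map_mul_pow_add hq k a 0 (by positivity)
  simpa [hf.map_zero hq] using h

lemma map_div_mul_map_mod (hf : IsStronglyQMultiplicative q f) (hq : 0 < q) (k x : ℕ) :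
    f x = f (x / q ^ k) * f (x % q ^ k) := by
  have hk : 0 < q ^ k := by positivity
  rw [← hf.map_mul_pow_add hq k _ _ (Nat.mod_lt x hk), Nat.div_add_mod']

end IsStronglyQMultiplicative

lemma sum_range_mul_eq {M : Type*} [AddCommMonoid M] (g : ℕ → M) (m n : ℕ) :
    ∑ u ∈ range (m * n), g u = ∑ a ∈ range m, ∑ b ∈ range n, g (a * n + b) := by
  induction m with
  | zero => simp
  | succ m ih => rw [add_mul, one_mul, sum_range_add, ih, sum_range_succ]

section Fourier

variable {q : ℕ} {f : ℕ → ℂ}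

lemma F_zero (hf : IsStronglyQMultiplicative q f) (hq : 0 < q) (t : ℝ) : F q f 0 t = 1 := by
  simp [F, hf.map_zero hq, e_zero]

/-- `F_{d+k}(t) = F_d(t) F_k(t/q^d)`. -/
lemma F_add (hf : IsStronglyQMultiplicative q f) (hq : 0 < q) (d k : ℕ) (t : ℝ) :
    F q f (d + k) t = F q f d t * F q f k (t / q ^ d) := by
  have hq' : (q : ℝ) ≠ 0 := by positivity
  simp only [F]
  rw [pow_add q d k, sum_range_mul_eq, mul_mul_mul_comm, sum_mul_sum]
  congr 1
  · rw [pow_add]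
    field_simp
  · refine sum_congr rfl fun a _ => sum_congr rfl fun b hb => ?_
    rw [hf.map_mul_pow_add hq k a b (mem_range.1 hb), mul_mul_mul_comm, ← e_add]
    congr 2
    push_cast
    field_simp
    ring

/-- `F_k` is periodic with period `q^k`. -/
lemma F_add_pow_mul (hq : 0 < q) (k : ℕ) (t : ℝ) (s : ℤ) :
    F q f k (t + q ^ k * s) = F q f k t := by
  have hq' : (q : ℝ) ≠ 0 := by positivity
  simp only [F]
  congr 1
  refine sum_congr rfl fun u _ => ?_
  congr 1
  refine e_eq_of_sub_eq_intCast (-(s * u)) ?_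
  push_cast
  field_simp
  ring

lemma norm_F_le_one (hf : IsStronglyQMultiplicative q f) (hq : 0 < q) (k : ℕ) (t : ℝ) :
    ‖F q f k t‖ ≤ 1 := by
  have h : ‖∑ u ∈ range (q ^ k), f u * e (-t * u / (q : ℝ) ^ k)‖ ≤ (q : ℝ) ^ k := by
    refine (norm_sum_le _ _).trans ?_
    simp [hf.norm_eq_one, norm_e]
  rw [F, norm_mul, norm_div, norm_pow, norm_one, Complex.norm_natCast, one_div_mul_eq_div]
  exact div_le_one_of_le₀ h (by positivity)

/-- Fourier inversion for the truncation of `f` to the lowest `k` digits. -/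
lemma map_mod_eq_sum_F (hq : 0 < q) (k x : ℕ) :
    f (x % q ^ k) = ∑ h ∈ range (q ^ k), F q f k h * e (h * x / q ^ k) := by
  have hQ : 0 < q ^ k := by positivity
  have hQ' : ((q : ℂ) ^ k) ≠ 0 := by
    have : (q : ℂ) ≠ 0 := by exact_mod_cast hq.ne'
    positivity
  have h1 : ∀ h ∈ range (q ^ k), F q f k h * e (h * x / q ^ k) =
      ∑ u ∈ range (q ^ k), 1 / (q : ℂ) ^ k * f u * e (h * (((x - u : ℤ) : ℝ) / (q ^ k : ℕ))) := by
    intro h _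
    rw [F, mul_sum, sum_mul]
    refine sum_congr rfl fun u _ => ?_
    rw [mul_assoc, mul_assoc, ← e_add, ← mul_assoc]
    congr 2
    push_cast
    ring
  rw [sum_congr rfl h1, sum_comm]
  simp only [← mul_sum, sum_e_div_eq_ite hQ]
  rw [sum_eq_single_of_mem (x % q ^ k) (mem_range.2 (Nat.mod_lt _ hQ))]
  · rw [if_pos]
    · push_cast
      field_simp
    · have := Nat.mod_modEq x (q ^ k)
      exact (Nat.modEq_iff_dvd.1 this)
  · intro u hu hne
    rw [if_neg, mul_zero]
    intro hd
    apply hne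
    have h2 : u ≡ x [MOD q ^ k] := Nat.modEq_iff_dvd.2 hd
    rw [← h2, Nat.mod_eq_of_lt (mem_range.1 hu)]

/-- Parseval's identity for shifted frequencies. -/
lemma sum_sq_norm_F_one (hf : IsStronglyQMultiplicative q f) (hq : 0 < q) (x : ℝ) :
    ∑ s ∈ range q, ‖F q f 1 (s + x)‖ ^ 2 = 1 := by
  have hq' : (q : ℝ) ≠ 0 := by positivity
  have hqc : (q : ℂ) ≠ 0 := by exact_mod_cast hq.ne'
  have h1 : ∀ s ∈ range q, ((‖F q f 1 (s + x)‖ ^ 2 : ℝ) : ℂ) =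
      ∑ u ∈ range q, ∑ v ∈ range q, 1 / (q : ℂ) ^ 2 * (f u * (starRingEnd ℂ) (f v) *
        e (x * ((v : ℝ) - u) / q)) * e (s * (((v - u : ℤ) : ℝ) / q)) := by
    intro s _
    rw [Complex.ofReal_pow, ← Complex.mul_conj', F]
    simp only [pow_one, map_mul, map_sum, conj_e, map_div₀, map_one, Complex.conj_natCast]
    rw [mul_mul_mul_comm, sum_mul_sum, mul_sum]
    refine sum_congr rfl fun u _ => ?_
    rw [mul_sum]
    refine sum_congr rfl fun v _ => ?_
    have h : e (-(s + x) * u / q) * e (-(-(s + x) * v / q)) =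
        e (x * (v - u) / q) * e (s * (((v - u : ℤ) : ℝ) / q)) := by
      rw [← e_add, ← e_add]
      congr 1
      push_cast
      field_simp
      ring
    linear_combination 1 / (q : ℂ) ^ 2 * (f u * (starRingEnd ℂ) (f v)) * h
  have h2 : ((∑ s ∈ range q, ‖F q f 1 (s + x)‖ ^ 2 : ℝ) : ℂ) = 1 := by
    rw [Complex.ofReal_sum, sum_congr rfl h1, sum_comm]
    have h3 : ∀ u ∈ range q, ∑ s ∈ range q, ∑ v ∈ range q, 1 / (q : ℂ) ^ 2 *
        (f u * (starRingEnd ℂ) (f v) * e (x * ((v : ℝ) - u) / q)) * e (s * (((v - u : ℤ) : ℝ) / q)) =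
        (1 / q : ℂ) := by
      intro u hu
      rw [sum_comm]
      simp only [← mul_sum, sum_e_div_eq_ite hq]
      rw [sum_eq_single_of_mem u hu]
      · have h4 : f u * (starRingEnd ℂ) (f u) = 1 := by
          rw [Complex.mul_conj', hf.norm_eq_one]
          simp
        simp [h4, e_zero]
        field_simp
      · intro v hv hne
        rw [if_neg, mul_zero]
        intro hd
        apply hne
        have h4 : u ≡ v [MOD q] := Nat.modEq_iff_dvd.2 hd
        rw [Nat.ModEq, Nat.mod_eq_of_lt (mem_range.1 hu), Nat.mod_eq_of_lt (mem_range.1 hv)] at h4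
        exact h4.symm
    rw [sum_congr rfl h3]
    simp [hqc]
  exact_mod_cast h2

/-- Summation over shifted frequencies splits according to the lowest digit. -/
lemma sum_norm_F_succ_pow (hf : IsStronglyQMultiplicative q f) (hq : 0 < q) (p k : ℕ) (x : ℝ) :
    ∑ s ∈ range (q ^ (k + 1)), ‖F q f (k + 1) (s + x)‖ ^ p =
      ∑ b ∈ range q, ‖F q f 1 (b + x)‖ ^ p *
        ∑ a ∈ range (q ^ k), ‖F q f k (a + (b + x) / q)‖ ^ p := by
  have hq' : (q : ℝ) ≠ 0 := by positivity
  rw [pow_succ, sum_range_mul_eq, sum_comm]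
  refine sum_congr rfl fun b _ => ?_
  rw [mul_sum]
  refine sum_congr rfl fun a _ => ?_
  rw [add_comm k 1, F_add hf hq, norm_mul, mul_pow]
  congr 3
  · rw [← F_add_pow_mul hq 1 (b + x) a]
    push_cast
    ring_nf
  · congr 1
    push_cast
    field_simp
    ring

lemma sum_sq_norm_F (hf : IsStronglyQMultiplicative q f) (hq : 0 < q) (k : ℕ) (x : ℝ) :
    ∑ s ∈ range (q ^ k), ‖F q f k (s + x)‖ ^ 2 = 1 := by
  induction k generalizing x with
  | zero => simp [F_zero hf hq]
  | succ k ih =>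
    rw [sum_norm_F_succ_pow hf hq]
    simp [ih, sum_sq_norm_F_one hf hq]

lemma sum_norm_F_le_pow (hf : IsStronglyQMultiplicative q f) (hq : 0 < q) {B : ℝ} (hB0 : 0 ≤ B)
    (hB : ∀ x : ℝ, ∑ s ∈ range q, ‖F q f 1 (s + x)‖ ≤ B) (k : ℕ) (x : ℝ) :
    ∑ s ∈ range (q ^ k), ‖F q f k (s + x)‖ ≤ B ^ k := by
  induction k generalizing x with
  | zero => simp [F_zero hf hq]
  | succ k ih =>
    have h := sum_norm_F_succ_pow hf hq 1 k x
    simp only [pow_one] at h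
    rw [h, pow_succ']
    calc _ ≤ ∑ b ∈ range q, ‖F q f 1 (b + x)‖ * B ^ k :=
          sum_le_sum fun b _ => mul_le_mul_of_nonneg_left (ih _) (norm_nonneg _)
      _ ≤ _ := by
          rw [← sum_mul]
          exact mul_le_mul_of_nonneg_right (hB x) (by positivity)

/-- `∑_{r < q} |F_1(r + x)| ≤ q^η` for all real `x`. -/
lemma sum_norm_F_one_le (hf : IsStronglyQMultiplicative q f) (hq : 1 < q) (x : ℝ) :
    ∑ s ∈ range q, ‖F q f 1 (s + x)‖ ≤ (q : ℝ) ^ η q f := by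
  have hq0 : 0 < q := by omega
  have hq' : (q : ℝ) ≠ 0 := by positivity
  have hlog : 0 < Real.log q := Real.log_pos (by exact_mod_cast hq)
  set g : Set.Icc (0 : ℝ) 1 → ℝ := fun t => ∑ r ∈ range q, ‖F q f 1 (q * t + r)‖ with hg
  have hbdd : BddAbove (Set.range g) := by
    refine ⟨q, ?_⟩
    rintro _ ⟨t, rfl⟩
    calc g t ≤ ∑ r ∈ range q, (1 : ℝ) := sum_le_sum fun r _ => norm_F_le_one hf hq0 _ _
      _ = q := by simp
  have hone : ∀ t, 1 ≤ g t := by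
    intro t
    rw [← sum_sq_norm_F_one hf hq0 (q * t)]
    refine sum_le_sum fun r _ => ?_
    rw [add_comm]
    have := norm_F_le_one hf hq0 1 (q * t + r)
    nlinarith [norm_nonneg (F q f 1 (q * t + r))]
  have hsup : (q : ℝ) ^ η q f = ⨆ t, g t := by
    have hpos : 0 < ⨆ t, g t :=
      lt_of_lt_of_le one_pos ((hone ⟨0, by simp⟩).trans (le_ciSup hbdd _))
    rw [η, Real.rpow_def_of_pos (by positivity), ← mul_assoc, mul_one_div_cancel hlog.ne', one_mul,
      Real.exp_log hpos]
  rw [hsup]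
  -- `η` only sees arguments `qt` with `t ∈ [0, 1]`; since `F_1` has period `q`, the fractional part
  -- of `x/q` represents every `x`.
  have hmem : Int.fract (x / q) ∈ Set.Icc (0 : ℝ) 1 :=
    ⟨Int.fract_nonneg _, (Int.fract_lt_one _).le⟩
  refine le_trans (le_of_eq ?_) (le_ciSup hbdd ⟨Int.fract (x / q), hmem⟩)
  refine sum_congr rfl fun r _ => ?_
  rw [← F_add_pow_mul hq0 1 (q * _ + r) ⌊x / q⌋]
  congr 2
  simp only [Int.fract]
  rw [mul_sub, mul_div_cancel₀ _ hq']
  ring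

/-- `∑_{h < q^k} |F_k(h + x)| ≤ q^{ηk}`. -/
lemma sum_norm_F_le (hf : IsStronglyQMultiplicative q f) (hq : 1 < q) (k : ℕ) (x : ℝ) :
    ∑ s ∈ range (q ^ k), ‖F q f k (s + x)‖ ≤ (q : ℝ) ^ (η q f * k) := by
  rw [Real.rpow_mul_natCast (by positivity)]
  exact sum_norm_F_le_pow hf (by omega) (by positivity) (sum_norm_F_one_le hf hq) k x

lemma norm_F_one_mul_le (hf : IsStronglyQMultiplicative q f) (hq : 1 < q) (hc : 0 < c q f)
    (t : ℝ) : ‖F q f 1 t * F q f 1 (q * t)‖ ≤ (q : ℝ) ^ (-(2 * c q f)) := by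
  have hq0 : 0 < q := by omega
  have hlog : 0 < Real.log q := Real.log_pos (by exact_mod_cast hq)
  have hbdd : BddAbove (Set.range fun t : ℝ => ‖F q f 1 t * F q f 1 (q * t)‖) := by
    refine ⟨1, ?_⟩
    rintro _ ⟨t, rfl⟩
    simp only [norm_mul]
    exact mul_le_one₀ (norm_F_le_one hf hq0 _ _) (norm_nonneg _) (norm_F_le_one hf hq0 _ _)
  refine (le_ciSup hbdd t).trans (le_of_eq ?_)
  have h0 : 0 ≤ ⨆ t : ℝ, ‖F q f 1 t * F q f 1 (q * t)‖ :=
    Real.iSup_nonneg fun _ => norm_nonneg _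
  -- By the convention `log 0 = 0`, a vanishing supremum would give `c = 0`.
  have h1 : (⨆ t : ℝ, ‖F q f 1 t * F q f 1 (q * t)‖) ≠ 0 := by
    intro h
    rw [c, h] at hc
    simp at hc
  have hpos := lt_of_le_of_ne h0 h1.symm
  rw [Real.rpow_def_of_pos (by positivity), c]
  conv_lhs => rw [← Real.exp_log hpos]
  congr 1
  field_simp

/-- `F_2(t) = F_1(t) F_1(t/q)` is the product in the definition of `c`, taken at `t/q`. -/
lemma norm_F_two_le (hf : IsStronglyQMultiplicative q f) (hq : 1 < q) (hc : 0 < c q f)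
    (t : ℝ) : ‖F q f 2 t‖ ≤ (q : ℝ) ^ (-(2 * c q f)) := by
  have hq0 : 0 < q := by omega
  have hq' : (q : ℝ) ≠ 0 := by positivity
  have h := norm_F_one_mul_le hf hq hc (t / q)
  rw [mul_div_cancel₀ _ hq', mul_comm] at h
  rw [show 2 = 1 + 1 from rfl, F_add hf hq0, pow_one]
  exact h

/-- `|F_k(t)| ≤ q^{c(1 - k)}`. -/
lemma norm_F_le (hf : IsStronglyQMultiplicative q f) (hq : 1 < q) (hc : 0 < c q f) (k : ℕ)
    (t : ℝ) : ‖F q f k t‖ ≤ (q : ℝ) ^ (c q f * (1 - k)) := by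
  have hq0 : 0 < q := by omega
  have hq1 : (1 : ℝ) ≤ q := by exact_mod_cast hq0
  induction k using Nat.twoStepInduction generalizing t with
  | zero =>
    rw [F_zero hf hq0, norm_one]
    exact Real.one_le_rpow hq1 (by simpa using hc.le)
  | one =>
    have := norm_F_le_one hf hq0 1 t
    simpa using this
  | more k ih _ =>
    rw [add_comm k 2, F_add hf hq0, norm_mul]
    have h1 := norm_F_two_le hf hq hc t
    have h2 := ih (t / q ^ 2)
    calc _ ≤ (q : ℝ) ^ (-(2 * c q f)) * (q : ℝ) ^ (c q f * (1 - k)) := by gcongr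
      _ = _ := by
        rw [← Real.rpow_add (by positivity)]
        congr 1
        push_cast
        ring

/-- Parseval for `F_2` gives `1 ≤ max |F_2| · ∑ |F_2| ≤ q^{-2c} q^{2η}`. This is how smallness of
`η` limits the saving that has to be proved. -/
lemma c_le_eta (hf : IsStronglyQMultiplicative q f) (hq : 1 < q) (hc : 0 < c q f) :
    c q f ≤ η q f := by
  have hq0 : 0 < q := by omega
  have hq1 : (1 : ℝ) < q := by exact_mod_cast hq
  have h1 := sum_sq_norm_F hf hq0 2 0
  have h2 := sum_norm_F_le hf hq 2 0
  have h3 : (1 : ℝ) ≤ (q : ℝ) ^ (-(2 * c q f)) * (q : ℝ) ^ (η q f * (2 : ℕ)) := by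
    rw [← h1]
    refine le_trans ?_ (mul_le_mul_of_nonneg_left h2 (by positivity))
    rw [mul_sum]
    refine sum_le_sum fun s _ => ?_
    rw [sq]
    exact mul_le_mul_of_nonneg_right (norm_F_two_le hf hq hc _) (norm_nonneg _)
  rw [← Real.rpow_add (by positivity)] at h3
  by_contra! hlt
  have h4 := Real.rpow_lt_one_of_one_lt_of_neg hq1
    (show -(2 * c q f) + η q f * (2 : ℕ) < 0 by push_cast; linarith)
  linarith

/-- For `q = 2` the quantity `η(f)` is at least `1/2`. -/
lemma ne_two_of_eta_lt_half (hf : IsStronglyQMultiplicative q f) (hη : η q f < 1 / 2) :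
    q ≠ 2 := by
  rintro rfl
  -- With this phase the two values of `F_1` are `(1 ± i)/2`, whose moduli sum to `√2`.
  obtain ⟨x, hx⟩ : ∃ x : ℝ, f 1 * e (-x) = Complex.I := by
    have h1 : ‖(starRingEnd ℂ) (f 1) * Complex.I‖ = 1 := by
      rw [norm_mul, RCLike.norm_conj, hf.norm_eq_one, Complex.norm_I, one_mul]
    obtain ⟨y, hy⟩ := (Complex.norm_eq_one_iff _).1 h1
    refine ⟨-(y / (2 * Real.pi)), ?_⟩
    have h2 : e (- -(y / (2 * Real.pi))) = (starRingEnd ℂ) (f 1) * Complex.I := by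
      rw [← hy, e]
      congr 1
      have : (Real.pi : ℂ) ≠ 0 := by exact_mod_cast Real.pi_ne_zero
      push_cast
      field_simp
    rw [h2, ← mul_assoc, Complex.mul_conj', hf.norm_eq_one]
    simp
  have h0 := hf.map_zero two_pos
  have h1 := sum_norm_F_one_le hf one_lt_two (2 * x)
  have hF : ∀ s : ℕ, F 2 f 1 (s + 2 * x) = 1 / 2 * (1 + Complex.I * e (-s / 2)) := by
    intro s
    rw [← hx, mul_assoc, ← e_add, F]
    simp only [pow_one, sum_range_succ, sum_range_zero, zero_add, h0]
    have h3 : -((s : ℝ) + 2 * x) * (1 : ℕ) / (2 : ℕ) = -x + -s / 2 := by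
      push_cast
      ring
    rw [h3]
    simp [e_zero]
  have he : e (-1 / 2) = -1 := by
    rw [e, ← Complex.exp_neg_pi_mul_I]
    congr 1
    push_cast
    ring
  have hn : ∀ y : ℝ, y ^ 2 = 1 → ‖(1 / 2 : ℂ) * (1 + Complex.I * y)‖ = Real.sqrt 2 / 2 := by
    intro y hy
    have : ‖(1 : ℂ) + Complex.I * y‖ = Real.sqrt 2 := by
      rw [mul_comm, ← Complex.ofReal_one, Complex.norm_add_mul_I, hy]
      norm_num
    rw [norm_mul, this]
    norm_num
    ring
  have h2 : Real.sqrt 2 ≤ (2 : ℝ) ^ η 2 f := by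
    refine le_trans (le_of_eq ?_) h1
    rw [sum_range_succ, sum_range_one, hF, hF]
    have ha := hn 1 (by norm_num)
    have hb := hn (-1) (by norm_num)
    simp only [Nat.cast_zero, neg_zero, zero_div, e_zero, Nat.cast_one, he]
    push_cast at ha hb
    rw [ha, hb]
    ring
  rw [Real.sqrt_eq_rpow, Real.rpow_le_rpow_left_iff one_lt_two] at h2
  linarith

end Fourier

/-! ### Van der Corput's inequality and quadratic exponential sums -/

/-- In each row the distance 0 occurs once and every `d ≥ 1` at most twice. -/
lemma sum_sum_le_of_dist {R : ℕ} (g : ℕ → ℕ → ℝ) (G : ℕ → ℝ) (hG : ∀ d, 0 ≤ G d)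
    (h1 : ∀ r d, r + d < R → g r (r + d) ≤ G d) (h2 : ∀ r d, r + d < R → g (r + d) r ≤ G d) :
    ∑ r ∈ range R, ∑ s ∈ range R, g r s ≤ R * (G 0 + 2 * ∑ d ∈ Ico 1 R, G d) := by
  have key : ∀ r ∈ range R, ∑ s ∈ range R, g r s ≤ G 0 + 2 * ∑ d ∈ Ico 1 R, G d := by
    intro r hr
    have hr' := mem_range.1 hr
    have hR : R = (r + 1) + (R - (r + 1)) := by omega
    have hA : ∑ s ∈ range (r + 1), g r s ≤ G 0 + ∑ d ∈ Ico 1 R, G d := by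
      rw [← sum_range_reflect, ← sum_range_eq_add_Ico _ (by omega : 0 < R)]
      refine (sum_le_sum (g := G) fun d hd => ?_).trans
        (sum_le_sum_of_subset_of_nonneg (range_subset_range.2 hr') fun d _ _ => hG d)
      have hd' := mem_range.1 hd
      have := h2 (r + 1 - 1 - d) d (by omega)
      rwa [show r + 1 - 1 - d + d = r by omega] at this
    have hB : ∑ s ∈ range (R - (r + 1)), g r (r + 1 + s) ≤ ∑ d ∈ Ico 1 R, G d := by
      rw [sum_Ico_eq_sum_range]
      refine (sum_le_sum (g := fun s => G (1 + s)) fun s hs => ?_).trans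
        (sum_le_sum_of_subset_of_nonneg (range_subset_range.2 (by omega)) fun d _ _ => hG _)
      have hs' := mem_range.1 hs
      have := h1 r (1 + s) (by omega)
      rwa [← add_assoc] at this
    have hsplit : ∑ s ∈ range R, g r s =
        ∑ s ∈ range (r + 1), g r s + ∑ s ∈ range (R - (r + 1)), g r (r + 1 + s) := by
      rw [← sum_range_add, ← hR]
    rw [hsplit]
    linarith
  refine (sum_le_sum key).trans (le_of_eq ?_)
  rw [sum_const, card_range, nsmul_eq_mul]

/-- Van der Corput's inequality. -/
lemma van_der_corput {z : ℕ → ℂ} (hz : ∀ n, ‖z n‖ ≤ 1) (a : ℕ) {b N R : ℕ} (hb : b ≤ N)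
    (hR : 0 < R) :
    R * ‖∑ n ∈ Ico a b, z n‖ ^ 2 ≤ (N + R) * (N + 2 * ∑ d ∈ Ico 1 R,
      ‖∑ n ∈ Ico a (b - d), z (n + d) * (starRingEnd ℂ) (z n)‖) := by
  set w : ℕ → ℂ := fun n => if n ∈ Ico a b then z n else 0 with hw
  -- `R` shifted copies of the sequence extended by zero, each with sum `S`; the guard `r ≤ k`
  -- neutralises truncated subtraction. Cauchy–Schwarz is applied over the `N + R` values of `k`.
  set v : ℕ → ℕ → ℂ := fun r k => if r ≤ k then w (k - r) else 0 with hv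
  set S := ∑ n ∈ Ico a b, z n
  set C : ℕ → ℂ := fun d => ∑ n ∈ Ico a (b - d), z (n + d) * (starRingEnd ℂ) (z n) with hC
  have hsplit : ∀ r < R, N + R = r + (N + R - r) := fun r hr => by omega
  have hv1 : ∀ r ∈ range R, ∑ k ∈ range (N + R), v r k = S := by
    intro r hr
    rw [hsplit r (mem_range.1 hr), sum_range_add, sum_eq_zero, zero_add]
    · simp only [hv, le_add_iff_nonneg_right, zero_le, if_true, add_tsub_cancel_left, hw]
      rw [sum_ite_mem, inter_eq_right.2]
      intro n hn
      have := mem_Ico.1 hn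
      have := mem_range.1 hr
      exact mem_range.2 (by omega)
    · intro k hk
      simp [hv, mem_range.1 hk]
  have hv2 : ∀ r d, r + d < R →
      ∑ k ∈ range (N + R), v r k * (starRingEnd ℂ) (v (r + d) k) = C d := by
    intro r d hrd
    rw [hsplit _ hrd, sum_range_add, sum_eq_zero, zero_add]
    · have h : ∀ x ∈ range (N + R - (r + d)), v r (r + d + x) *
          (starRingEnd ℂ) (v (r + d) (r + d + x)) =
          if x ∈ Ico a (b - d) then z (x + d) * (starRingEnd ℂ) (z x) else 0 := by
        intro x _
        have e1 : v r (r + d + x) = w (x + d) := by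
          simp only [hv]
          rw [if_pos (by omega)]
          congr 1
          omega
        have e2 : v (r + d) (r + d + x) = w x := by
          simp only [hv]
          rw [if_pos (by omega)]
          congr 1
          omega
        rw [e1, e2]
        simp only [hw, mem_Ico]
        split_ifs <;> first | rfl | omega | simp
      rw [sum_congr rfl h, sum_ite_mem, inter_eq_right.2]
      intro n hn
      have := mem_Ico.1 hn
      exact mem_range.2 (by omega)
    · intro k hk
      simp [hv, mem_range.1 hk]
  have hv3 : ∀ r d, r + d < R →
      ∑ k ∈ range (N + R), v (r + d) k * (starRingEnd ℂ) (v r k) = (starRingEnd ℂ) (C d) := by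
    intro r d hrd
    rw [← hv2 r d hrd, map_sum]
    refine sum_congr rfl fun k _ => ?_
    rw [map_mul, Complex.conj_conj, mul_comm]
  have h1 : (R : ℂ) * S = ∑ k ∈ range (N + R), ∑ r ∈ range R, v r k := by
    rw [sum_comm, sum_congr rfl hv1]
    simp
  have h2 : ((R : ℝ) * ‖S‖) ^ 2 ≤ (N + R) * ∑ k ∈ range (N + R), ‖∑ r ∈ range R, v r k‖ ^ 2 := by
    have h3 : (R : ℝ) * ‖S‖ ≤ ∑ k ∈ range (N + R), ‖∑ r ∈ range R, v r k‖ := by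
      rw [← Complex.norm_natCast, ← norm_mul, h1]
      exact norm_sum_le _ _
    refine (pow_le_pow_left₀ (by positivity) h3 2).trans ?_
    have := sq_sum_le_card_mul_sum_sq (s := range (N + R))
      (f := fun k => ‖∑ r ∈ range R, v r k‖)
    simpa using this
  have h3 : ∑ k ∈ range (N + R), ‖∑ r ∈ range R, v r k‖ ^ 2 ≤
      ∑ r ∈ range R, ∑ s ∈ range R, ‖∑ k ∈ range (N + R), v r k * (starRingEnd ℂ) (v s k)‖ := by
    have h4 : ((∑ k ∈ range (N + R), ‖∑ r ∈ range R, v r k‖ ^ 2 : ℝ) : ℂ) =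
        ∑ r ∈ range R, ∑ s ∈ range R, ∑ k ∈ range (N + R), v r k * (starRingEnd ℂ) (v s k) := by
      push_cast
      simp only [← Complex.mul_conj', map_sum, sum_mul_sum]
      rw [sum_comm]
      exact sum_congr rfl fun r _ => sum_comm
    calc _ ≤ |∑ k ∈ range (N + R), ‖∑ r ∈ range R, v r k‖ ^ 2| := le_abs_self _
      _ = ‖((∑ k ∈ range (N + R), ‖∑ r ∈ range R, v r k‖ ^ 2 : ℝ) : ℂ)‖ := by
          rw [Complex.norm_real, Real.norm_eq_abs]
      _ ≤ _ := by
          rw [h4]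
          exact (norm_sum_le _ _).trans (sum_le_sum fun r _ => norm_sum_le _ _)
  have h4 := sum_sum_le_of_dist (R := R)
    (fun r s => ‖∑ k ∈ range (N + R), v r k * (starRingEnd ℂ) (v s k)‖) (fun d => ‖C d‖)
    (fun _ => norm_nonneg _) (fun r d h => (congrArg norm (hv2 r d h)).le)
    (fun r d h => by simp only [hv3 r d h, RCLike.norm_conj, le_refl])
  have h5 : ‖C 0‖ ≤ N := by
    refine (norm_sum_le _ _).trans ?_
    calc _ ≤ ∑ n ∈ Ico a (b - 0), (1 : ℝ) := by
          refine sum_le_sum fun n _ => ?_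
          rw [norm_mul, RCLike.norm_conj]
          exact mul_le_one₀ (hz _) (norm_nonneg _) (hz _)
      _ ≤ N := by
          simp only [sum_const, Nat.card_Ico, nsmul_eq_mul, mul_one]
          exact_mod_cast (by omega : b - 0 - a ≤ N)
  have hRpos : (0 : ℝ) < R := by exact_mod_cast hR
  have h6 : ((R : ℝ) * ‖S‖) ^ 2 ≤ (N + R) * (R * (N + 2 * ∑ d ∈ Ico 1 R, ‖C d‖)) := by
    refine h2.trans (mul_le_mul_of_nonneg_left (h3.trans (h4.trans ?_)) (by positivity))
    gcongr
  refine le_of_mul_le_mul_left ?_ hRpos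
  calc _ = ((R : ℝ) * ‖S‖) ^ 2 := by ring
    _ ≤ _ := h6
    _ = _ := by ring

/-- Multiplication by `ω` shifts the interval by `Q`, so in the difference everything cancels except
two end blocks of length `Q`. -/
lemma norm_one_sub_mul_norm_sum_le {z : ℕ → ℂ} {ω : ℂ} {Q : ℕ} (hz : ∀ n, ‖z n‖ ≤ 1)
    (h : ∀ n, z (n + Q) = ω * z n) (a b : ℕ) :
    ‖1 - ω‖ * ‖∑ n ∈ Ico a b, z n‖ ≤ 2 * Q := by
  rcases le_or_gt a b with hab | hab
  · have h1 : (1 - ω) * ∑ n ∈ Ico a b, z n =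
        ∑ n ∈ Ico a (a + Q), z n - ∑ n ∈ Ico b (b + Q), z n := by
      have h2 : ω * ∑ n ∈ Ico a b, z n = ∑ n ∈ Ico (a + Q) (b + Q), z n := by
        rw [mul_sum, ← sum_Ico_add']
        exact sum_congr rfl fun n _ => (h n).symm
      have h3 := sum_Ico_consecutive z hab (Nat.le_add_right b Q)
      have h4 := sum_Ico_consecutive z (Nat.le_add_right a Q) (Nat.add_le_add_right hab Q)
      rw [sub_mul, one_mul, h2, sub_eq_sub_iff_add_eq_add, h3, ← h4]
    have h5 : ∀ d, ‖∑ n ∈ Ico d (d + Q), z n‖ ≤ Q := by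
      intro d
      refine (norm_sum_le _ _).trans ?_
      calc _ ≤ ∑ n ∈ Ico d (d + Q), (1 : ℝ) := sum_le_sum fun n _ => hz n
        _ = Q := by simp
    rw [← norm_mul, h1]
    refine (norm_sub_le _ _).trans ?_
    linarith [h5 a, h5 b]
  · rw [Ico_eq_empty_of_le hab.le]
    simp

lemma sum_range_zmod {Q : ℕ} [NeZero Q] (g : ZMod Q → ℝ) :
    ∑ b ∈ range Q, g (b : ZMod Q) = ∑ x, g x := by
  refine sum_nbij' (fun b => (b : ZMod Q)) ZMod.val (fun _ _ => mem_univ _)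
    (fun x _ => mem_range.2 (ZMod.val_lt x)) (fun b hb => ?_) (fun x _ => ?_) (fun _ _ => rfl)
  · exact ZMod.val_cast_of_lt (mem_range.1 hb)
  · exact ZMod.natCast_zmod_val x

/-- `|1 - e(b/Q)|` is at least `4 min(b, Q-b)/Q`, and the reciprocal of the minimum is at most the
sum of both reciprocals. -/
lemma two_div_norm_one_sub_e_le {Q b : ℕ} (hb : 0 < b) (hbQ : b < Q) :
    2 / ‖1 - e ((b : ℝ) / Q)‖ ≤ Q / 2 * (1 / b + 1 / (Q - b : ℕ)) := by
  have hQ : (0 : ℝ) < Q := by exact_mod_cast (by omega : 0 < Q)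
  have hb' : (0 : ℝ) < b := by exact_mod_cast hb
  have hc' : (0 : ℝ) < (Q - b : ℕ) := by exact_mod_cast (by omega : 0 < Q - b)
  have hcast : ((Q - b : ℕ) : ℝ) = Q - b := Nat.cast_sub hbQ.le
  have key : ∀ c : ℕ, 0 < c → 2 * c ≤ Q → 2 / (2 * |Real.sin (Real.pi * ((c : ℝ) / Q))|) ≤
      Q / 2 * (1 / c) := by
    intro c hc hcQ
    have hc1 : (0 : ℝ) < c := by exact_mod_cast hc
    have hc2 : (2 : ℝ) * c ≤ Q := by exact_mod_cast hcQ
    have h := two_mul_le_sin_pi_mul (x := (c : ℝ) / Q) (by positivity)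
      (by rw [div_le_div_iff₀ hQ two_pos]; linarith)
    have h2 := le_abs_self (Real.sin (Real.pi * ((c : ℝ) / Q)))
    calc _ ≤ 2 / (2 * (2 * ((c : ℝ) / Q))) := by
          apply div_le_div_of_nonneg_left (by norm_num) (by positivity)
          linarith
      _ = _ := by field_simp
  rw [norm_one_sub_e]
  rcases le_total (2 * b) Q with h | h
  · refine (key b hb h).trans ?_
    gcongr
    simp
  · have hs : Real.sin (Real.pi * ((b : ℝ) / Q)) =
        Real.sin (Real.pi * (((Q - b : ℕ) : ℝ) / Q)) := by
      rw [← Real.sin_pi_sub]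
      congr 1
      rw [hcast]
      field_simp
    rw [hs]
    refine (key (Q - b) (by omega) (by omega)).trans ?_
    gcongr
    simp

lemma sum_Ico_two_div_norm_one_sub_e_le (Q : ℕ) :
    ∑ b ∈ Ico 1 Q, 2 / ‖1 - e ((b : ℝ) / Q)‖ ≤ Q * (1 + Real.log Q) := by
  have h1 : ∑ b ∈ Ico 1 Q, 2 / ‖1 - e ((b : ℝ) / Q)‖ ≤
      ∑ b ∈ Ico 1 Q, (Q / 2 * (1 / (b : ℝ)) + Q / 2 * (1 / ((Q - b : ℕ) : ℝ))) := by
    refine sum_le_sum fun b hb => ?_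
    rw [← mul_add]
    exact two_div_norm_one_sub_e_le (mem_Ico.1 hb).1 (mem_Ico.1 hb).2
  have h2 : ∑ b ∈ Ico 1 Q, (Q / 2 * (1 / ((Q - b : ℕ) : ℝ))) =
      ∑ b ∈ Ico 1 Q, ((Q : ℝ) / 2 * (1 / (b : ℝ))) := by
    have := sum_Ico_reflect (fun b : ℕ => ((Q : ℝ) / 2 * (1 / (b : ℝ)))) 1 (m := Q) (n := Q)
      (by omega)
    simpa using this
  have h3 : ∑ b ∈ Ico 1 Q, 1 / (b : ℝ) ≤ 1 + Real.log Q := by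
    refine le_trans ?_ (harmonic_le_one_add_log Q)
    rw [harmonic_eq_sum_Icc]
    push_cast
    simp only [one_div]
    refine sum_le_sum_of_subset_of_nonneg ?_ fun _ _ _ => by positivity
    intro x hx
    simp only [mem_Ico, mem_Icc] at *
    omega
  refine h1.trans ?_
  rw [sum_add_distrib, h2, ← mul_sum]
  have hQ : (0 : ℝ) ≤ Q := by positivity
  nlinarith

/-- Weyl's bound for a quadratic exponential sum whose leading coefficient is a fraction with
denominator `Q`. -/
lemma sq_norm_sum_quadratic_le {Q : ℕ} (hQ : 0 < Q) {A : ℤ} (hA : IsCoprime (2 * A) (Q : ℤ))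
    (β γ : ℝ) (a : ℕ) {b N : ℕ} (hb : b ≤ N) :
    ‖∑ n ∈ Ico a b, e (A * n ^ 2 / Q + β * n + γ)‖ ^ 2 ≤
      2 * N + 4 * ((N / Q + 1) * (N + Q * (1 + Real.log Q))) := by
  have hlogQ : 0 ≤ Real.log Q := Real.log_natCast_nonneg Q
  rcases Nat.eq_zero_or_pos N with rfl | hN
  · obtain rfl : b = 0 := by omega
    simp
    positivity
  have hQ' : (Q : ℝ) ≠ 0 := by positivity
  have : NeZero Q := ⟨hQ.ne'⟩
  set z : ℕ → ℂ := fun n => e (A * n ^ 2 / Q + β * n + γ) with hzdef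
  -- Bound for a geometric sum of ratio `e(x/Q)` and at most `N` terms. Differencing at distance `d`
  -- produces such a sum with `x = 2Ad`.
  set w : ZMod Q → ℝ := fun x => if x = 0 then (N : ℝ) else 2 / ‖1 - e ((x.val : ℝ) / Q)‖ with hw
  have hw0 : ∀ x, 0 ≤ w x := by
    intro x
    simp only [hw]
    split_ifs <;> positivity
  have hcorr : ∀ d : ℕ, ‖∑ n ∈ Ico a (b - d), z (n + d) * (starRingEnd ℂ) (z n)‖ ≤
      w (((2 * A : ℤ) : ZMod Q) * (d : ZMod Q)) := by
    intro d
    set y : ℕ → ℂ := fun n => z (n + d) * (starRingEnd ℂ) (z n) with hy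
    have hy1 : ∀ n, ‖y n‖ ≤ 1 := by
      intro n
      simp only [hy, hzdef, norm_mul, RCLike.norm_conj, norm_e, mul_one, le_refl]
    simp only [hw]
    split_ifs with h0
    · refine (norm_sum_le _ _).trans ?_
      calc _ ≤ ∑ n ∈ Ico a (b - d), (1 : ℝ) := sum_le_sum fun n _ => hy1 n
        _ ≤ N := by
          simp only [sum_const, Nat.card_Ico, nsmul_eq_mul, mul_one]
          exact_mod_cast (by omega : b - d - a ≤ N)
    · set x : ZMod Q := ((2 * A : ℤ) : ZMod Q) * (d : ZMod Q) with hx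
      obtain ⟨k, hk⟩ : (Q : ℤ) ∣ 2 * A * d - x.val := by
        rw [← ZMod.intCast_zmod_eq_zero_iff_dvd]
        push_cast
        rw [ZMod.natCast_zmod_val, hx]
        push_cast
        ring
      have hkr : (2 * A * d - x.val : ℝ) = Q * k := by exact_mod_cast hk
      have hω : ∀ n, y (n + 1) = e ((x.val : ℝ) / Q) * y n := by
        intro n
        simp only [hy, hzdef, conj_e, ← e_add]
        apply e_eq_of_sub_eq_intCast k
        push_cast
        field_simp
        linear_combination hkr
      have hle := norm_one_sub_mul_norm_sum_le hy1 hω a (b - d)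
      have hpos : 0 < ‖1 - e ((x.val : ℝ) / Q)‖ := by
        have hv0 : 0 < x.val := Nat.pos_of_ne_zero fun h => h0 ((ZMod.val_eq_zero x).1 h)
        obtain ⟨u, hu⟩ := exists_int_four_mul_abs_sub_le ((x.val : ℝ) / Q)
        refine lt_of_lt_of_le ?_ hu
        have : (x.val : ℝ) / Q - u ≠ 0 := by
          intro h
          have h2 : (x.val : ℝ) = Q * u := by
            field_simp at h
            linarith
          have h3 : (x.val : ℤ) = Q * u := by exact_mod_cast h2
          have h4 := Int.le_of_dvd (by exact_mod_cast hv0) (Dvd.intro _ h3.symm)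
          have h5 := ZMod.val_lt x
          omega
        positivity
      rw [le_div_iff₀ hpos, mul_comm]
      simpa using hle
  have hunit : IsUnit ((2 * A : ℤ) : ZMod Q) := by
    obtain ⟨u, v, huv⟩ := hA
    refine IsUnit.of_mul_eq_one (u : ZMod Q) ?_
    have := congrArg (Int.cast : ℤ → ZMod Q) huv
    push_cast at this ⊢
    rw [ZMod.natCast_self, mul_zero, add_zero] at this
    rw [← this]
    ring
  obtain ⟨U, hU⟩ := hunit
  have hperm : ∑ x : ZMod Q, w (((2 * A : ℤ) : ZMod Q) * x) = ∑ x, w x := by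
    rw [← hU]
    exact Equiv.sum_comp (Units.mulLeft U) w
  have hsumw : ∑ x, w x ≤ N + Q * (1 + Real.log Q) := by
    rw [← sum_range_zmod, sum_range_eq_add_Ico _ hQ]
    refine add_le_add (by simp [hw]) ?_
    refine le_trans (le_of_eq (sum_congr rfl fun b hb => ?_)) (sum_Ico_two_div_norm_one_sub_e_le Q)
    have hb' := mem_Ico.1 hb
    have hval : (b : ZMod Q).val = b := ZMod.val_cast_of_lt hb'.2
    have hne : (b : ZMod Q) ≠ 0 := by
      intro h
      rw [← ZMod.val_eq_zero, hval] at h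
      omega
    simp only [hw, if_neg hne, hval]
  -- The range of `d` is covered by `⌊N/Q⌋ + 1` complete residue systems, and `d ↦ 2Ad` permutes
  -- each of them.
  have hsum : ∑ d ∈ Ico 1 N, w (((2 * A : ℤ) : ZMod Q) * (d : ZMod Q)) ≤
      (N / Q + 1) * (N + Q * (1 + Real.log Q)) := by
    calc _ ≤ ∑ d ∈ range ((N / Q + 1) * Q), w (((2 * A : ℤ) : ZMod Q) * (d : ZMod Q)) := by
          refine sum_le_sum_of_subset_of_nonneg ?_ fun _ _ _ => hw0 _
          intro d hd
          have := (mem_Ico.1 hd).2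
          have h2 := Nat.lt_div_mul_add (a := N) hQ
          rw [mem_range, add_mul]
          omega
      _ = ∑ _i ∈ range (N / Q + 1), ∑ x, w x := by
          rw [sum_range_mul_eq]
          refine sum_congr rfl fun i _ => ?_
          rw [← hperm, ← sum_range_zmod (fun x => w (((2 * A : ℤ) : ZMod Q) * x))]
          simp
      _ = ((N / Q : ℕ) + 1) * ∑ x, w x := by simp
      _ ≤ _ := by
          gcongr
          exact Nat.cast_div_le
  have hvdc := van_der_corput (z := z) (fun n => (norm_e _).le) a hb hN
  have hN' : (0 : ℝ) < N := by exact_mod_cast hN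
  have h1 : ∑ d ∈ Ico 1 N, ‖∑ n ∈ Ico a (b - d), z (n + d) * (starRingEnd ℂ) (z n)‖ ≤
      (N / Q + 1) * (N + Q * (1 + Real.log Q)) := (sum_le_sum fun d _ => hcorr d).trans hsum
  refine le_of_mul_le_mul_left (hvdc.trans ?_) hN'
  nlinarith

/-- The logarithm is absorbed in `10 Y^{1/10}`, and `11/20` is half of `1 + 1/10`. Any exponent
safely below `2/3` would serve, since `Y = q^Λ` with `Λ` at most about `3ν/2`. -/
lemma norm_sum_quadratic_le {Q : ℕ} (hQ : 0 < Q) {A : ℤ} (hA : IsCoprime (2 * A) (Q : ℤ))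
    (β γ : ℝ) (a : ℕ) {b N : ℕ} (hb : b ≤ N) {Y : ℝ} (hY : 1 ≤ Y) (hQY : Q ≤ Y) (hNY : N ≤ Y) :
    ‖∑ n ∈ Ico a b, e (A * n ^ 2 / Q + β * n + γ)‖ ≤
      2 * (N * (Q : ℝ) ^ (-(1 / 2) : ℝ)) + 10 * Y ^ (11 / 20 : ℝ) := by
  have hQ' : (0 : ℝ) < Q := by exact_mod_cast hQ
  have hY0 : 0 < Y := by linarith
  have h := sq_norm_sum_quadratic_le hQ hA β γ a hb
  set T := ‖∑ n ∈ Ico a b, e (A * n ^ 2 / Q + β * n + γ)‖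
  have hlog : Real.log Q ≤ 10 * Y ^ (1 / 10 : ℝ) := by
    refine (Real.log_le_log hQ' hQY).trans ?_
    refine (Real.log_le_rpow_div hY0.le (by norm_num : (0 : ℝ) < 1 / 10)).trans (le_of_eq ?_)
    ring
  have hone : 1 ≤ Y ^ (1 / 10 : ℝ) := Real.one_le_rpow hY (by norm_num)
  set V := Y ^ (1 / 10 : ℝ) with hV
  have hYV : (Y ^ (11 / 20 : ℝ)) ^ 2 = Y * V := by
    rw [hV, ← Real.rpow_natCast, ← Real.rpow_mul hY0.le]
    conv_rhs => rw [← Real.rpow_one Y, ← Real.rpow_mul hY0.le, ← Real.rpow_add hY0]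
    norm_num
  have hsq : ((Q : ℝ) ^ (-(1 / 2) : ℝ)) ^ 2 = 1 / Q := by
    rw [← Real.rpow_natCast, ← Real.rpow_mul hQ'.le]
    norm_num [Real.rpow_neg_one]
  have hN0 : (0 : ℝ) ≤ N := by positivity
  have h2 : T ^ 2 ≤ (2 * (N * (Q : ℝ) ^ (-(1 / 2) : ℝ))) ^ 2 + (10 * Y ^ (11 / 20 : ℝ)) ^ 2 := by
    have h3 : (2 * (N * (Q : ℝ) ^ (-(1 / 2) : ℝ))) ^ 2 = 4 * (N * N / Q) := by
      rw [mul_pow, mul_pow, hsq]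
      ring
    have h4 : 4 * (((N : ℝ) / Q + 1) * (N + Q * (1 + Real.log Q))) =
        4 * (N * N / Q) + 4 * (N * (1 + Real.log Q)) + 4 * N + 4 * (Q * (1 + Real.log Q)) := by
      field_simp
      ring
    have hH : 1 + Real.log Q ≤ 11 * V := by linarith
    have hH0 : 0 ≤ 1 + Real.log Q := by
      have := Real.log_natCast_nonneg Q
      linarith
    have h5 : N * (1 + Real.log Q) ≤ Y * (11 * V) := mul_le_mul hNY hH hH0 hY0.le
    have h6 : Q * (1 + Real.log Q) ≤ Y * (11 * V) := mul_le_mul hQY hH hH0 hY0.le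
    have h7 : Y ≤ Y * V := le_mul_of_one_le_right hY0.le hone
    rw [h3, mul_pow, hYV]
    linarith
  have hx : 0 ≤ 2 * (N * (Q : ℝ) ^ (-(1 / 2) : ℝ)) := by positivity
  have hy : 0 ≤ 10 * Y ^ (11 / 20 : ℝ) := by positivity
  refine le_of_sq_le_sq (h2.trans ?_) (by positivity)
  nlinarith [mul_nonneg hx hy]

/-! ### Truncation of the digits -/

/-- Each counted `n` adds at least 1 to `∑ (φ(n+r) - φ(n))`, which telescopes to at most the `r`
last values of `φ`. -/
lemma card_filter_ne_le {φ : ℕ → ℕ} (hφ : Monotone φ) (a : ℕ) {b r N : ℕ} (hb : b ≤ N) :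
    #{n ∈ Ico a (b - r) | φ (n + r) ≠ φ n} ≤ r * φ N := by
  rcases le_or_gt b r with hbr | hbr
  · simp [Nat.sub_eq_zero_of_le hbr]
  set K := b - r with hK
  have h1 : #{n ∈ Ico a K | φ (n + r) ≠ φ n} + ∑ n ∈ range K, φ n ≤
      ∑ n ∈ range K, φ (r + n) := by
    have h2 : #{n ∈ Ico a K | φ (n + r) ≠ φ n} ≤ #{n ∈ range K | φ (n + r) ≠ φ n} := by
      apply card_le_card
      apply filter_subset_filter
      intro n hn
      exact mem_range.2 (mem_Ico.1 hn).2
    refine (Nat.add_le_add_right h2 _).trans ?_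
    rw [card_filter, ← sum_add_distrib]
    refine sum_le_sum fun n _ => ?_
    have := hφ (Nat.le_add_right n r)
    rw [add_comm r n]
    split_ifs <;> omega
  have h2 : ∑ n ∈ range r, φ n + ∑ n ∈ range K, φ (r + n) =
      ∑ n ∈ range K, φ n + ∑ n ∈ range r, φ (K + n) := by
    rw [← sum_range_add, ← sum_range_add, add_comm]
  have h3 : ∑ n ∈ range r, φ (K + n) ≤ r * φ N := by
    calc _ ≤ ∑ n ∈ range r, φ N := by
          refine sum_le_sum fun n hn => hφ ?_
          have := mem_range.1 hn
          omega
      _ = _ := by simp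
  omega

/-- If the digits above position `l` agree at `n` and `n + r`, their contributions to `f` cancel in
the product with the conjugate. The number of exceptions is controlled by monotonicity of
`m²n²/q^l`. -/
lemma norm_sum_sub_sum_mod_le {q : ℕ} {f : ℕ → ℂ} (hf : IsStronglyQMultiplicative q f)
    (hq : 0 < q) (l m a : ℕ) {b r N : ℕ} (hb : b ≤ N) :
    ‖∑ n ∈ Ico a (b - r), f (m ^ 2 * (n + r) ^ 2) * (starRingEnd ℂ) (f (m ^ 2 * n ^ 2)) -
      ∑ n ∈ Ico a (b - r), f (m ^ 2 * (n + r) ^ 2 % q ^ l) *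
        (starRingEnd ℂ) (f (m ^ 2 * n ^ 2 % q ^ l))‖ ≤ 2 * (r * (m ^ 2 * N ^ 2 / (q : ℝ) ^ l)) := by
  set φ : ℕ → ℕ := fun n => m ^ 2 * n ^ 2 / q ^ l with hφ
  have hmono : Monotone φ := by
    intro x y hxy
    simp only [hφ]
    gcongr
  have h1 : ∀ n ∈ Ico a (b - r), ‖f (m ^ 2 * (n + r) ^ 2) * (starRingEnd ℂ) (f (m ^ 2 * n ^ 2)) -
      f (m ^ 2 * (n + r) ^ 2 % q ^ l) * (starRingEnd ℂ) (f (m ^ 2 * n ^ 2 % q ^ l))‖ ≤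
      2 * (if φ (n + r) ≠ φ n then 1 else 0) := by
    intro n _
    split_ifs with h
    · refine (norm_sub_le _ _).trans ?_
      simp only [norm_mul, RCLike.norm_conj, hf.norm_eq_one]
      norm_num
    · have h' : m ^ 2 * (n + r) ^ 2 / q ^ l = m ^ 2 * n ^ 2 / q ^ l := not_not.1 h
      rw [hf.map_div_mul_map_mod hq l (m ^ 2 * (n + r) ^ 2), hf.map_div_mul_map_mod hq l
        (m ^ 2 * n ^ 2), h', map_mul, mul_mul_mul_comm, Complex.mul_conj', hf.norm_eq_one]
      simp
  rw [← sum_sub_distrib]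
  refine (norm_sum_le _ _).trans ((sum_le_sum h1).trans ?_)
  rw [← mul_sum, sum_boole]
  have h2 : (#{n ∈ Ico a (b - r) | φ (n + r) ≠ φ n} : ℝ) ≤ r * φ N := by
    exact_mod_cast card_filter_ne_le hmono a hb
  have h3 : (φ N : ℝ) ≤ m ^ 2 * N ^ 2 / (q : ℝ) ^ l := by
    refine Nat.cast_div_le.trans (le_of_eq ?_)
    push_cast
    rfl
  gcongr
  exact h2.trans (by gcongr)

/-! ### Sums of Fourier coefficients over residue classes -/

section Classes

variable {q : ℕ} {f : ℕ → ℂ}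

lemma F_mul_pow_add (hq : 0 < q) (k s x : ℕ) :
    F q f k ((s * q ^ k + x : ℕ) : ℝ) = F q f k x := by
  rw [← F_add_pow_mul hq k x s]
  congr 1
  push_cast
  ring

/-- On a residue class modulo `q^d` the factor `F_d` is constant, so `L¹` and `L²` sums over the
class reduce to complete sums of a shifted `F_k`. -/
lemma norm_F_add_mul_pow (hf : IsStronglyQMultiplicative q f) (hq : 0 < q) (d k s a : ℕ) :
    ‖F q f (d + k) ((s * q ^ d + a : ℕ) : ℝ)‖ = ‖F q f d a‖ * ‖F q f k (s + a / q ^ d)‖ := by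
  have hq' : (q : ℝ) ≠ 0 := by positivity
  rw [F_add hf hq, norm_mul, F_mul_pow_add hq]
  congr 3
  push_cast
  field_simp

lemma sum_class_sq_norm_F (hf : IsStronglyQMultiplicative q f) (hq : 0 < q) (d k a : ℕ) :
    ∑ s ∈ range (q ^ k), ‖F q f (d + k) ((s * q ^ d + a : ℕ) : ℝ)‖ ^ 2 = ‖F q f d a‖ ^ 2 := by
  simp only [norm_F_add_mul_pow hf hq, mul_pow]
  rw [← mul_sum, sum_sq_norm_F hf hq, mul_one]

lemma sum_class_norm_F_le (hf : IsStronglyQMultiplicative q f) (hq : 1 < q) (d k a : ℕ) :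
    ∑ s ∈ range (q ^ k), ‖F q f (d + k) ((s * q ^ d + a : ℕ) : ℝ)‖ ≤
      (q : ℝ) ^ (η q f * k) * ‖F q f d a‖ := by
  simp only [norm_F_add_mul_pow hf (by omega)]
  rw [← mul_sum, mul_comm]
  exact mul_le_mul_of_nonneg_right (sum_norm_F_le hf hq _ _) (norm_nonneg _)

lemma sum_range_ite_periodic {D Q : ℕ} (P : ℕ → Prop) [DecidablePred P] (hP : ∀ s a, P (s * D + a) ↔ P a)
    (G : ℕ → ℝ) :
    ∑ h ∈ range (Q * D), (if P h then G h else 0) =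
      ∑ a ∈ range D, if P a then ∑ s ∈ range Q, G (s * D + a) else 0 := by
  rw [sum_range_mul_eq, sum_comm]
  refine sum_congr rfl fun a _ => ?_
  simp only [hP]
  split_ifs <;> simp

open Classical in
/-- The sum of `|F_d(a)|²` over a set of residues which is periodic modulo `q^l` does not depend on
`d ≥ l`. -/
lemma sum_ite_sq_norm_F (hf : IsStronglyQMultiplicative q f) (hq : 0 < q) (l k : ℕ) (P : ℕ → Prop)
    (hP : ∀ s a, P (s * q ^ l + a) ↔ P a) :
    ∑ a ∈ range (q ^ (l + k)), (if P a then ‖F q f (l + k) a‖ ^ 2 else 0) =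
      ∑ a ∈ range (q ^ l), if P a then ‖F q f l a‖ ^ 2 else 0 := by
  rw [pow_add q l k, mul_comm, sum_range_ite_periodic P hP]
  simp only [sum_class_sq_norm_F hf hq]

open Classical in
-- Summing over `k`, and then over `h` in a class modulo `q^{l+i}`, each costs the `L¹` norm
-- `q^{ηj}` of the top `j` digits and leaves a factor `|F_{l+i}|`. The resulting squares collapse to
-- level `l` because `P` only depends on the residue modulo `q^l`.
lemma sum_sum_modEq_le (hf : IsStronglyQMultiplicative q f) (hq : 1 < q) (l i j : ℕ)
    (P : ℕ → Prop) (hP : ∀ s a, P (s * q ^ l + a) ↔ P a) :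
    ∑ h ∈ range (q ^ (l + i + j)), (if P h then ∑ k ∈ range (q ^ (l + i + j)),
      (if h ≡ k [MOD q ^ (l + i)] then
        ‖F q f (l + i + j) h‖ * ‖F q f (l + i + j) k‖ else 0) else 0) ≤
      ((q : ℝ) ^ (η q f * j)) ^ 2 *
        ∑ b ∈ range (q ^ l), if P b then ‖F q f l b‖ ^ 2 else 0 := by
  have hq0 : 0 < q := by omega
  set d := l + i with hd
  have hPd : ∀ s a, P (s * q ^ d + a) ↔ P a := by
    intro s a
    rw [hd, pow_add, mul_comm (q ^ l), ← mul_assoc]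
    exact hP _ _
  have hclass : ∀ h : ℕ, ∑ k ∈ range (q ^ (d + j)),
      (if h ≡ k [MOD q ^ d] then ‖F q f (d + j) h‖ * ‖F q f (d + j) k‖ else 0) ≤
      ‖F q f (d + j) h‖ * ((q : ℝ) ^ (η q f * j) * ‖F q f d h‖) := by
    intro h
    have hper : ∀ s a, h ≡ s * q ^ d + a [MOD q ^ d] ↔ h ≡ a [MOD q ^ d] := by
      intro s a
      simp [Nat.ModEq]
    have hDpos : 0 < q ^ d := by positivity
    rw [pow_add q d j, mul_comm (q ^ d), sum_range_ite_periodic _ hper,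
      sum_eq_single_of_mem (h % q ^ d) (mem_range.2 (Nat.mod_lt _ hDpos)), if_pos, ← mul_sum]
    · refine mul_le_mul_of_nonneg_left ((sum_class_norm_F_le hf hq _ _ _).trans (le_of_eq ?_))
        (norm_nonneg _)
      congr 2
      conv_rhs => rw [← Nat.div_add_mod' h (q ^ d), F_mul_pow_add hq0]
    · exact (Nat.mod_modEq _ _).symm
    · intro a ha hne
      rw [if_neg]
      intro hc
      apply hne
      rw [hc, Nat.mod_eq_of_lt (mem_range.1 ha)]
  calc _ ≤ ∑ h ∈ range (q ^ (d + j)), (if P h then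
        ‖F q f (d + j) h‖ * ((q : ℝ) ^ (η q f * j) * ‖F q f d h‖) else 0) := by
        refine sum_le_sum fun h _ => ?_
        split_ifs
        · exact hclass h
        · exact le_rfl
    _ = ∑ a ∈ range (q ^ d), (if P a then ∑ s ∈ range (q ^ j),
        ‖F q f (d + j) ((s * q ^ d + a : ℕ) : ℝ)‖ *
          ((q : ℝ) ^ (η q f * j) * ‖F q f d ((s * q ^ d + a : ℕ) : ℝ)‖) else 0) := by
        conv_lhs => rw [pow_add q d j, mul_comm (q ^ d), sum_range_ite_periodic P hPd]
    _ ≤ ∑ a ∈ range (q ^ d), (if P a then ((q : ℝ) ^ (η q f * j)) ^ 2 * ‖F q f d a‖ ^ 2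
        else 0) := by
        refine sum_le_sum fun a _ => ?_
        split_ifs
        · simp only [F_mul_pow_add hq0]
          rw [← sum_mul]
          refine (mul_le_mul_of_nonneg_right (sum_class_norm_F_le hf hq d j a)
            (by positivity)).trans (le_of_eq ?_)
          ring
        · exact le_rfl
    _ = _ := by
        rw [← sum_ite_sq_norm_F hf hq0 l i P hP, mul_sum]
        refine sum_congr rfl fun a _ => ?_
        split_ifs <;> simp [hd]

/-- Frequencies `b` for which `bM` is close to a multiple of `q^{l+σ+ρ}` carry a small part of the
`L²`-mass of `F`. -/
lemma sum_sq_norm_F_near_multiple_le (hf : IsStronglyQMultiplicative q f) (hq : q.Prime)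
    (hc : 0 < c q f) {l σ ρ v M : ℕ} (hv : v ≤ ρ) (hM : ¬ q ∣ M) (B : Finset ℕ)
    (hB : B ⊆ range (q ^ (l + σ + ρ)))
    (hbad : ∀ b ∈ B, ∃ y : ℤ,
      2 * |(b : ℤ) * (q ^ v * M : ℕ) - y * (q : ℤ) ^ (l + σ + ρ)| < (q : ℤ) ^ l) :
    ∑ b ∈ B, ‖F q f (l + σ + ρ) b‖ ^ 2 ≤ ((q : ℝ) ^ (c q f * (1 - σ))) ^ 2 := by
  have hq0 := hq.pos
  have hq1 := hq.one_lt
  -- For two such frequencies congruent modulo `q^l`, the difference `X` of their signed distances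
  -- to the chosen multiples is divisible by `q^l` and smaller than `q^l`, hence zero. As `q ∤ M`
  -- and `v ≤ ρ`, at most `ρ` powers of `q` are lost on cancelling `q^v M`.
  have hinj : ∀ b ∈ B, ∀ b' ∈ B, b ≡ b' [MOD q ^ l] → b ≡ b' [MOD q ^ (l + σ)] := by
    intro b hb b' hb' hmod
    obtain ⟨y, hy⟩ := hbad b hb
    obtain ⟨y', hy'⟩ := hbad b' hb'
    have hd : (q : ℤ) ^ l ∣ b' - b := by exact_mod_cast Nat.modEq_iff_dvd.1 hmod
    set X : ℤ := ((b' : ℤ) * (q ^ v * M : ℕ) - y' * (q : ℤ) ^ (l + σ + ρ)) -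
      ((b : ℤ) * (q ^ v * M : ℕ) - y * (q : ℤ) ^ (l + σ + ρ)) with hX
    have hX2 : X = (b' - b) * (q ^ v * M : ℕ) - (y' - y) * (q : ℤ) ^ (l + σ + ρ) := by
      rw [hX]
      ring
    have hdvd : (q : ℤ) ^ l ∣ X := by
      rw [hX2]
      refine dvd_sub (hd.mul_right _) (Dvd.dvd.mul_left ?_ _)
      exact pow_dvd_pow _ (by omega)
    have hX0 : X = 0 := by
      refine Int.eq_zero_of_abs_lt_dvd hdvd ?_
      have := abs_sub ((b' : ℤ) * (q ^ v * M : ℕ) - y' * (q : ℤ) ^ (l + σ + ρ))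
        ((b : ℤ) * (q ^ v * M : ℕ) - y * (q : ℤ) ^ (l + σ + ρ))
      rw [hX]
      linarith
    have hqp : Prime (q : ℤ) := Nat.prime_iff_prime_int.1 hq
    have h1 : (q : ℤ) ^ (l + σ + ρ) ∣ ((b' - b) * (q : ℤ) ^ v) * M := by
      refine ⟨y' - y, ?_⟩
      have := hX2.symm.trans hX0
      push_cast at this
      linear_combination this
    have h2 := hqp.pow_dvd_of_dvd_mul_right _ (by exact_mod_cast hM) h1
    have h3 : (q : ℤ) ^ (l + σ + (ρ - v)) ∣ b' - b := by
      have h4 : (q : ℤ) ^ (l + σ + ρ) = (q : ℤ) ^ (l + σ + (ρ - v)) * (q : ℤ) ^ v := by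
        rw [← pow_add]
        congr 1
        omega
      rw [h4] at h2
      exact Int.dvd_of_mul_dvd_mul_right (by have := hqp.ne_zero; positivity) h2
    rw [Nat.modEq_iff_dvd]
    push_cast
    exact (pow_dvd_pow _ (by omega)).trans h3
  -- The members of `B` in a class modulo `q^l` thus lie in one class modulo `q^{l+σ}`, of mass
  -- `|F_{l+σ}(b₁)|²`; its factor `F_σ` gives the saving.
  have hfiber : ∀ a ∈ range (q ^ l), ∑ b ∈ B with b % q ^ l = a, ‖F q f (l + σ + ρ) b‖ ^ 2 ≤
      ‖F q f l a‖ ^ 2 * ((q : ℝ) ^ (c q f * (1 - σ))) ^ 2 := by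
    intro a ha
    rcases ({b ∈ B | b % q ^ l = a}).eq_empty_or_nonempty with hE | ⟨b₀, hb₀⟩
    · rw [hE, sum_empty]
      positivity
    rw [mem_filter] at hb₀
    set b₁ := b₀ % q ^ (l + σ) with hb₁
    have hb₁a : b₁ = b₁ / q ^ l * q ^ l + a := by
      conv_lhs => rw [← Nat.div_add_mod' b₁ (q ^ l)]
      congr 1
      rw [← hb₀.2, hb₁, Nat.mod_mod_of_dvd _ (pow_dvd_pow q (Nat.le_add_right l σ))]
    calc ∑ b ∈ B with b % q ^ l = a, ‖F q f (l + σ + ρ) b‖ ^ 2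
        ≤ ∑ b ∈ (range (q ^ ρ)).image (fun s => s * q ^ (l + σ) + b₁),
            ‖F q f (l + σ + ρ) b‖ ^ 2 := by
          refine sum_le_sum_of_subset_of_nonneg ?_ fun _ _ _ => by positivity
          intro b hb
          rw [mem_filter] at hb
          have hmod := hinj b hb.1 b₀ hb₀.1 (hb.2.trans hb₀.2.symm)
          rw [mem_image]
          refine ⟨b / q ^ (l + σ), ?_, ?_⟩
          · rw [mem_range, Nat.div_lt_iff_lt_mul (by positivity), ← pow_add, add_comm ρ]
            exact mem_range.1 (hB hb.1)
          · rw [hb₁, ← hmod, Nat.div_add_mod']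
      _ = ∑ s ∈ range (q ^ ρ), ‖F q f (l + σ + ρ) ((s * q ^ (l + σ) + b₁ : ℕ) : ℝ)‖ ^ 2 := by
          refine sum_image fun s _ t _ hst => ?_
          have : 0 < q ^ (l + σ) := by positivity
          exact Nat.eq_of_mul_eq_mul_right this (Nat.add_right_cancel hst)
      _ = ‖F q f l b₁‖ ^ 2 * ‖F q f σ (b₁ / q ^ l)‖ ^ 2 := by
          rw [sum_class_sq_norm_F hf hq0, F_add hf hq0, norm_mul, mul_pow]
      _ ≤ _ := by
          have h1 : F q f l b₁ = F q f l a := by rw [hb₁a, F_mul_pow_add hq0]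
          rw [h1]
          gcongr
          exact norm_F_le hf hq1 hc _ _
  rw [← sum_fiberwise_of_maps_to (s := B) (t := range (q ^ l)) (g := fun b => b % q ^ l)
    (fun b _ => mem_range.2 (Nat.mod_lt _ (by positivity)))]
  refine (sum_le_sum hfiber).trans (le_of_eq ?_)
  rw [← sum_mul]
  have := sum_sq_norm_F hf hq0 l 0
  simp only [add_zero] at this
  rw [this, one_mul]

end Classes

/-! ### Correlations of the truncated function -/

section Correlation

variable {q : ℕ} {f : ℕ → ℂ}

/-- The quadratic exponential sums that arise from a pair `(h, k)` of frequencies. -/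
noncomputable def pairSum (q l m r a b : ℕ) (h k : ℕ) : ℂ :=
  ∑ n ∈ Ico a b, e (h * (m ^ 2 * (n + r) ^ 2 : ℕ) / q ^ l - k * (m ^ 2 * n ^ 2 : ℕ) / q ^ l)

lemma norm_pairSum_le (q l m r a b h k : ℕ) {N : ℕ} (hb : b ≤ N) :
    ‖pairSum q l m r a b h k‖ ≤ N := by
  refine (norm_sum_le _ _).trans ?_
  simp only [norm_e, sum_const, Nat.card_Ico, nsmul_eq_mul, mul_one]
  exact_mod_cast (by omega : b - a ≤ N)

lemma norm_sum_corr_mod_le (hq : 0 < q) (l m r a b : ℕ) :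
    ‖∑ n ∈ Ico a b, f (m ^ 2 * (n + r) ^ 2 % q ^ l) *
      (starRingEnd ℂ) (f (m ^ 2 * n ^ 2 % q ^ l))‖ ≤
    ∑ h ∈ range (q ^ l), ∑ k ∈ range (q ^ l),
      ‖F q f l h‖ * ‖F q f l k‖ * ‖pairSum q l m r a b h k‖ := by
  have h1 : ∑ n ∈ Ico a b, f (m ^ 2 * (n + r) ^ 2 % q ^ l) *
      (starRingEnd ℂ) (f (m ^ 2 * n ^ 2 % q ^ l)) =
      ∑ h ∈ range (q ^ l), ∑ k ∈ range (q ^ l),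
        F q f l h * (starRingEnd ℂ) (F q f l k) * pairSum q l m r a b h k := by
    simp only [pairSum, mul_sum]
    rw [sum_congr rfl fun h _ => sum_comm, sum_comm]
    refine sum_congr rfl fun n _ => ?_
    rw [map_mod_eq_sum_F (f := f) hq, map_mod_eq_sum_F (f := f) hq, map_sum, sum_mul_sum]
    refine sum_congr rfl fun h _ => sum_congr rfl fun k _ => ?_
    rw [map_mul, conj_e, mul_mul_mul_comm, ← e_add, ← sub_eq_add_neg]
  rw [h1]
  refine (norm_sum_le _ _).trans (sum_le_sum fun h _ => ?_)
  refine (norm_sum_le _ _).trans (sum_le_sum fun k _ => ?_)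
  rw [norm_mul, norm_mul, RCLike.norm_conj]

/-- The leading coefficient is `A m²/q^j` in lowest terms. Oddness of `q` keeps the doubled
numerator coprime to `q`, as Weyl differencing requires. -/
lemma norm_pairSum_le_of_exact (hq : q.Prime) (hq2 : q ≠ 2) {m : ℕ} (hm : ¬ q ∣ m)
    (d j r a : ℕ) {b N h k : ℕ} (hb : b ≤ N) (hN : N ≤ q ^ (d + j)) {A : ℤ}
    (hA : ¬ (q : ℤ) ∣ A) (hhk : (h : ℤ) - k = q ^ d * A) :
    ‖pairSum q (d + j) m r a b h k‖ ≤
      2 * (N * ((q : ℝ) ^ j) ^ (-(1 / 2) : ℝ)) + 10 * ((q : ℝ) ^ (d + j)) ^ (11 / 20 : ℝ) := by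
  have hq0 := hq.pos
  have hq1 : (1 : ℝ) ≤ q := by exact_mod_cast hq.one_lt.le
  have hq' : (q : ℝ) ≠ 0 := by positivity
  have hqp : Prime (q : ℤ) := Nat.prime_iff_prime_int.1 hq
  have hnd : ¬ (q : ℤ) ∣ 2 * (A * m ^ 2) := by
    intro hd
    rcases hqp.dvd_or_dvd hd with h2 | h2
    · have : q ∣ 2 := by exact_mod_cast h2
      exact hq2 ((Nat.prime_dvd_prime_iff_eq hq Nat.prime_two).1 this)
    · rcases hqp.dvd_or_dvd h2 with h3 | h3
      · exact hA h3
      · exact hm (by exact_mod_cast hqp.dvd_of_dvd_pow h3)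
  have hcop : IsCoprime (2 * (A * m ^ 2)) ((q ^ j : ℕ) : ℤ) := by
    push_cast
    exact (IsCoprime.pow_left ((hqp.irreducible.coprime_iff_not_dvd).2 hnd)).symm
  have hhk' : (h : ℝ) - k = q ^ d * A := by exact_mod_cast hhk
  have hQ : 0 < q ^ j := by positivity
  have key := norm_sum_quadratic_le hQ hcop (2 * h * m ^ 2 * r / q ^ (d + j))
    (h * m ^ 2 * r ^ 2 / q ^ (d + j)) a hb (Y := (q : ℝ) ^ (d + j)) (one_le_pow₀ hq1)
    (by push_cast; exact pow_le_pow_right₀ hq1 (by omega)) (by exact_mod_cast hN)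
  push_cast at key
  refine le_trans (le_of_eq ?_) key
  rw [pairSum]
  congr 1
  refine sum_congr rfl fun n _ => ?_
  congr 1
  have hk' : (h : ℝ) = k + q ^ d * A := by linarith
  push_cast
  rw [pow_add]
  field_simp
  rw [hk']
  ring

/-- Here the leading coefficient has denominator dividing `q^j`, so shifting `n` by `q^j` changes
the phase by `2hm²r/q^l` up to an integer. -/
lemma norm_one_sub_mul_norm_pairSum_le (hq : 0 < q) (l j m r a b : ℕ) {h k : ℕ}
    (hhk : (q : ℤ) ^ l ∣ h - k) :
    ‖1 - e (h * (2 * m ^ 2 * r : ℕ) / q ^ l)‖ * ‖pairSum q (l + j) m r a b h k‖ ≤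
      2 * q ^ j := by
  have hq' : (q : ℝ) ≠ 0 := by positivity
  obtain ⟨A, hA⟩ := hhk
  have hA' : (h : ℝ) = k + q ^ l * A := by
    have : (h : ℝ) - k = q ^ l * A := by exact_mod_cast hA
    linarith
  have := norm_one_sub_mul_norm_sum_le (Q := q ^ j)
    (ω := e (h * (2 * m ^ 2 * r : ℕ) / q ^ l))
    (z := fun n => e (h * (m ^ 2 * (n + r) ^ 2 : ℕ) / q ^ (l + j) -
      k * (m ^ 2 * n ^ 2 : ℕ) / q ^ (l + j))) (fun n => (norm_e _).le) (fun n => ?_) a b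
  · push_cast at this
    rw [pairSum]
    push_cast
    exact this
  · rw [← e_add]
    apply e_eq_of_sub_eq_intCast (A * m ^ 2 * (2 * n + q ^ j))
    push_cast
    rw [pow_add]
    field_simp
    rw [hA']
    ring

open Classical in
-- With `q^j` the exact denominator of `(h-k)/q^{l+J}`: for `j ≥ J` Weyl's bound is covered by the
-- first bracket; for `j < J` quasi-periodicity gives `2q^J/δ` unless `h` is exceptional, and then
-- Weyl's main term is the `j`-th summand. The diagonal `h = k` belongs to `j = 0`.
lemma norm_pairSum_le_add (hq : q.Prime) (hq2 : q ≠ 2) {m : ℕ} (hm : ¬ q ∣ m) (l J r a : ℕ)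
    {b N : ℕ} (hb : b ≤ N) (hN : N ≤ q ^ (l + J)) {δ : ℝ} (hδ : 0 < δ) (h k : ℕ)
    (hh : h < q ^ (l + J)) (hk : k < q ^ (l + J)) :
    ‖pairSum q (l + J) m r a b h k‖ ≤
      (10 * ((q : ℝ) ^ (l + J)) ^ (11 / 20 : ℝ) + 2 * (N * ((q : ℝ) ^ J) ^ (-(1 / 2) : ℝ)) +
        2 * q ^ J / δ) +
      ∑ j ∈ range (J + 1), (if ‖1 - e (h * (2 * m ^ 2 * r : ℕ) / q ^ l)‖ < δ then
        (if h ≡ k [MOD q ^ (l + (J - j))] then 2 * (N * ((q : ℝ) ^ j) ^ (-(1 / 2) : ℝ)) else 0)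
        else 0) := by
  have hq0 := hq.pos
  have hq1 : (1 : ℝ) ≤ q := by exact_mod_cast hq.one_lt.le
  have hpos : (0 : ℝ) < q := by positivity
  set T := ‖pairSum q (l + J) m r a b h k‖ with hT
  set Y := 10 * ((q : ℝ) ^ (l + J)) ^ (11 / 20 : ℝ) with hY
  have hY0 : 0 ≤ Y := by positivity
  have hE2 : 0 ≤ 2 * (N * ((q : ℝ) ^ J) ^ (-(1 / 2) : ℝ)) := by positivity
  have hE3 : 0 ≤ 2 * (q : ℝ) ^ J / δ := by positivity
  set g : ℕ → ℝ := fun j => (if ‖1 - e (h * (2 * m ^ 2 * r : ℕ) / q ^ l)‖ < δ then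
        (if h ≡ k [MOD q ^ (l + (J - j))] then 2 * (N * ((q : ℝ) ^ j) ^ (-(1 / 2) : ℝ)) else 0)
        else 0) with hg
  have hg0 : ∀ j ∈ range (J + 1), 0 ≤ g j := by
    intro j _
    simp only [hg]
    split_ifs <;> positivity
  have hsum0 := sum_nonneg hg0
  have hsingle : ∀ j ≤ J, g j ≤ ∑ j ∈ range (J + 1), g j := fun j hj =>
    single_le_sum hg0 (mem_range.2 (by omega))
  have hnotbad : (q : ℤ) ^ l ∣ h - k → ¬ ‖1 - e (h * (2 * m ^ 2 * r : ℕ) / q ^ l)‖ < δ →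
      T ≤ 2 * q ^ J / δ := by
    intro hd hnb
    have := norm_one_sub_mul_norm_pairSum_le hq0 l J m r a b hd
    rw [le_div_iff₀ hδ, mul_comm]
    exact (mul_le_mul_of_nonneg_right (not_lt.1 hnb) (norm_nonneg _)).trans this
  rcases eq_or_ne h k with rfl | hne
  · by_cases hbad : ‖1 - e (h * (2 * m ^ 2 * r : ℕ) / q ^ l)‖ < δ
    · have h0 : g 0 = 2 * N := by
        simp only [hg, if_pos hbad, if_pos (Nat.ModEq.refl h)]
        simp
      have h1 := hsingle 0 (by omega)
      have h2 := norm_pairSum_le q (l + J) m r a b h h hb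
      have h3 : (0 : ℝ) ≤ N := by positivity
      linarith
    · have := hnotbad (by simp) hbad
      linarith
  · have hne' : (h : ℤ) - k ≠ 0 := by
      intro h0
      exact hne (by omega)
    have hfin : FiniteMultiplicity (q : ℤ) ((h : ℤ) - k) := by
      rw [Int.finiteMultiplicity_iff]
      exact ⟨by simpa using hq.ne_one, hne'⟩
    obtain ⟨A, hA, hqA⟩ := hfin.exists_eq_pow_mul_and_not_dvd
    set d := multiplicity (q : ℤ) ((h : ℤ) - k) with hd
    have hdlt : d < l + J := by
      by_contra! hge
      have h1 : (q : ℤ) ^ (l + J) ∣ h - k := (pow_dvd_pow _ hge).trans ⟨A, hA⟩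
      refine hne' (Int.eq_zero_of_abs_lt_dvd h1 ?_)
      have h2 : (h : ℤ) < (q : ℤ) ^ (l + J) := by exact_mod_cast hh
      have h3 : (k : ℤ) < (q : ℤ) ^ (l + J) := by exact_mod_cast hk
      rw [abs_lt]
      constructor <;> omega
    obtain ⟨j, hj⟩ := Nat.exists_eq_add_of_lt hdlt
    have hj' : l + J = d + (j + 1) := by omega
    have hexact : T ≤ 2 * (N * ((q : ℝ) ^ (j + 1)) ^ (-(1 / 2) : ℝ)) + Y := by
      rw [hT, hY, hj']
      exact norm_pairSum_le_of_exact hq hq2 hm d (j + 1) r a hb (hj' ▸ hN) hqA hA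
    rcases le_or_gt J (j + 1) with hJ | hJ
    · have : ((q : ℝ) ^ (j + 1)) ^ (-(1 / 2) : ℝ) ≤ ((q : ℝ) ^ J) ^ (-(1 / 2) : ℝ) :=
        Real.rpow_le_rpow_of_nonpos (by positivity) (pow_le_pow_right₀ hq1 hJ) (by norm_num)
      have : (N : ℝ) * ((q : ℝ) ^ (j + 1)) ^ (-(1 / 2) : ℝ) ≤
          N * ((q : ℝ) ^ J) ^ (-(1 / 2) : ℝ) := by gcongr
      linarith
    · by_cases hbad : ‖1 - e (h * (2 * m ^ 2 * r : ℕ) / q ^ l)‖ < δ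
      · have hmod : h ≡ k [MOD q ^ (l + (J - (j + 1)))] := by
          rw [show l + (J - (j + 1)) = d by omega]
          apply Nat.ModEq.symm
          rw [Nat.modEq_iff_dvd]
          push_cast
          exact ⟨A, hA⟩
        have h0 : g (j + 1) = 2 * (N * ((q : ℝ) ^ (j + 1)) ^ (-(1 / 2) : ℝ)) := by
          simp only [hg, if_pos hbad, if_pos hmod]
        have h1 := hsingle (j + 1) hJ.le
        linarith
      · have := hnotbad ((pow_dvd_pow _ (by omega)).trans ⟨A, hA⟩) hbad
        linarith

/-- Bound for the correlations of the truncation of `n ↦ f(m²n²)`. -/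
lemma norm_sum_corr_mod_le_of_params (hf : IsStronglyQMultiplicative q f) (hq : q.Prime)
    (hq2 : q ≠ 2) (hc : 0 < c q f) (hη : η q f ≤ 1 / 4) {m : ℕ} (hm : ¬ q ∣ m) (l σ J a : ℕ)
    {b N ρ r : ℕ} (hb : b ≤ N) (hN : N ≤ q ^ (l + σ + ρ + J)) (hr : 0 < r) (hrρ : r < q ^ ρ)
    {δ : ℝ} (hδ : 0 < δ) (hδl : δ * q ^ (l + σ + ρ) ≤ q ^ l) :
    ‖∑ n ∈ Ico a b, f (m ^ 2 * (n + r) ^ 2 % q ^ (l + σ + ρ + J)) *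
      (starRingEnd ℂ) (f (m ^ 2 * n ^ 2 % q ^ (l + σ + ρ + J)))‖ ≤
    (10 * ((q : ℝ) ^ (l + σ + ρ + J)) ^ (11 / 20 : ℝ) +
        2 * (N * ((q : ℝ) ^ J) ^ (-(1 / 2) : ℝ)) + 2 * q ^ J / δ) *
        ((q : ℝ) ^ (η q f * (l + σ + ρ + J : ℕ))) ^ 2 +
      2 * N * (J + 1) * ((q : ℝ) ^ (c q f * (1 - σ))) ^ 2 := by
  classical
  have hq0 := hq.pos
  have hq1 : (1 : ℝ) ≤ q := by exact_mod_cast hq.one_lt.le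
  have hpos : (0 : ℝ) < q := by positivity
  have hq' : (q : ℝ) ≠ 0 := hpos.ne'
  set L := l + σ + ρ with hL
  set E := 10 * ((q : ℝ) ^ (L + J)) ^ (11 / 20 : ℝ) +
        2 * (N * ((q : ℝ) ^ J) ^ (-(1 / 2) : ℝ)) + 2 * q ^ J / δ with hE
  set P : ℕ → Prop := fun h => ‖1 - e (h * (2 * m ^ 2 * r : ℕ) / q ^ L)‖ < δ with hPdef
  set Φ : ℕ → ℝ := fun h => ‖F q f (L + J) h‖ with hΦ
  have hE0 : 0 ≤ E := by positivity
  have hP : ∀ s a, P (s * q ^ L + a) ↔ P a := by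
    intro s a
    simp only [hPdef]
    rw [e_eq_of_sub_eq_intCast (s * (2 * m ^ 2 * r))]
    push_cast
    field_simp
    ring
  -- Since `0 < r < q^ρ`, at most `ρ` factors `q` divide `2m²r`; `q` is odd and prime to `m`, so all
  -- of them come from `r`.
  have hbadsum : ∑ x ∈ range (q ^ L), (if P x then ‖F q f L x‖ ^ 2 else 0) ≤
      ((q : ℝ) ^ (c q f * (1 - σ))) ^ 2 := by
    obtain ⟨v, M, hM, hrM⟩ := Nat.exists_eq_pow_mul_and_not_dvd hr.ne' q hq.ne_one
    have hv : v ≤ ρ := by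
      by_contra! hlt
      have h1 : q ^ ρ ≤ q ^ v := Nat.pow_le_pow_right hq0 hlt.le
      have h2 : 0 < M := Nat.pos_of_ne_zero fun h => hM (h ▸ dvd_zero q)
      nlinarith [Nat.pow_pos (n := v) hq0]
    have hM' : ¬ q ∣ 2 * m ^ 2 * M := by
      intro hd
      rcases (hq.dvd_mul).1 hd with h1 | h1
      · rcases (hq.dvd_mul).1 h1 with h2 | h2
        · exact hq2 ((Nat.prime_dvd_prime_iff_eq hq Nat.prime_two).1 h2)
        · exact hm (hq.dvd_of_dvd_pow h2)
      · exact hM h1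
    rw [← sum_filter]
    refine sum_sq_norm_F_near_multiple_le hf hq hc (l := l) (σ := σ) hv hM' _
      (filter_subset _ _) fun x hx => ?_
    obtain ⟨y, hy⟩ := exists_int_four_mul_abs_sub_le
      ((x : ℝ) * (2 * m ^ 2 * r : ℕ) / q ^ L)
    refine ⟨y, ?_⟩
    have h1 := hy.trans_lt (mem_filter.1 hx).2
    have h2 : (x : ℝ) * (2 * m ^ 2 * r : ℕ) / q ^ L - y =
        ((x : ℝ) * (2 * m ^ 2 * r : ℕ) - y * q ^ L) / q ^ L := by field_simp
    rw [h2, abs_div, abs_of_pos (by positivity : (0 : ℝ) < q ^ L), ← mul_div_assoc,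
      div_lt_iff₀ (by positivity)] at h1
    have h3 : 2 * |(x : ℝ) * (2 * m ^ 2 * r : ℕ) - y * q ^ L| < q ^ l := by
      linarith [abs_nonneg ((x : ℝ) * (2 * m ^ 2 * r : ℕ) - y * q ^ L)]
    have h4 : 2 * m ^ 2 * r = q ^ v * (2 * m ^ 2 * M) := by
      rw [hrM]
      ring
    rw [h4] at h3
    exact_mod_cast h3
  have hΦsum : ∑ h ∈ range (q ^ (L + J)), Φ h ≤ (q : ℝ) ^ (η q f * (L + J : ℕ)) := by
    have := sum_norm_F_le hf hq.one_lt (L + J) 0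
    simpa using this
  have hclass : ∀ j ∈ range (J + 1), ∑ h ∈ range (q ^ (L + J)), ∑ k ∈ range (q ^ (L + J)),
      Φ h * Φ k * (if P h then (if h ≡ k [MOD q ^ (L + (J - j))] then
        2 * (N * ((q : ℝ) ^ j) ^ (-(1 / 2) : ℝ)) else 0) else 0) ≤
      2 * N * ((q : ℝ) ^ (c q f * (1 - σ))) ^ 2 := by
    intro j hj
    have hj' := mem_range.1 hj
    have hLJ : L + J = L + (J - j) + j := by omega
    have h1 := sum_sum_modEq_le hf hq.one_lt L (J - j) j P hP
    rw [← hLJ] at h1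
    -- Weyl's saving `q^{-j/2}` pays for the `L¹` loss `q^{2ηj}`; this is where `η ≤ 1/4` enters.
    have h2 : ((q : ℝ) ^ j) ^ (-(1 / 2) : ℝ) * ((q : ℝ) ^ (η q f * j)) ^ 2 ≤ 1 := by
      rw [← Real.rpow_natCast (q : ℝ) j, ← Real.rpow_mul hpos.le, ← Real.rpow_natCast _ 2,
        ← Real.rpow_mul hpos.le, ← Real.rpow_add hpos]
      apply Real.rpow_le_one_of_one_le_of_nonpos hq1
      have : (0 : ℝ) ≤ j := by positivity
      push_cast
      nlinarith
    calc _ = 2 * (N * ((q : ℝ) ^ j) ^ (-(1 / 2) : ℝ)) *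
          ∑ h ∈ range (q ^ (L + J)), (if P h then ∑ k ∈ range (q ^ (L + J)),
          (if h ≡ k [MOD q ^ (L + (J - j))] then Φ h * Φ k else 0) else 0) := by
          rw [mul_sum]
          refine sum_congr rfl fun h _ => ?_
          split_ifs
          · rw [mul_sum]
            refine sum_congr rfl fun k _ => ?_
            split_ifs <;> ring
          · simp
      _ ≤ 2 * (N * ((q : ℝ) ^ j) ^ (-(1 / 2) : ℝ)) * (((q : ℝ) ^ (η q f * j)) ^ 2 *
          ((q : ℝ) ^ (c q f * (1 - σ))) ^ 2) := by
          refine mul_le_mul_of_nonneg_left (h1.trans ?_) (by positivity)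
          gcongr
      _ = 2 * N * ((q : ℝ) ^ (c q f * (1 - σ))) ^ 2 *
          (((q : ℝ) ^ j) ^ (-(1 / 2) : ℝ) * ((q : ℝ) ^ (η q f * j)) ^ 2) := by ring
      _ ≤ _ := mul_le_of_le_one_right (by positivity) h2
  calc _ ≤ ∑ h ∈ range (q ^ (L + J)), ∑ k ∈ range (q ^ (L + J)),
        Φ h * Φ k * ‖pairSum q (L + J) m r a b h k‖ := norm_sum_corr_mod_le hq0 _ _ _ _ _
    _ ≤ ∑ h ∈ range (q ^ (L + J)), ∑ k ∈ range (q ^ (L + J)),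
        Φ h * Φ k * (E + ∑ j ∈ range (J + 1), (if P h then
          (if h ≡ k [MOD q ^ (L + (J - j))] then
            2 * (N * ((q : ℝ) ^ j) ^ (-(1 / 2) : ℝ)) else 0) else 0)) := by
        refine sum_le_sum fun h hh => sum_le_sum fun k hk => ?_
        exact mul_le_mul_of_nonneg_left (norm_pairSum_le_add hq hq2 hm L J r a hb hN hδ h k
          (mem_range.1 hh) (mem_range.1 hk)) (by positivity)
    _ = E * (∑ h ∈ range (q ^ (L + J)), Φ h) ^ 2 + ∑ j ∈ range (J + 1),
        ∑ h ∈ range (q ^ (L + J)), ∑ k ∈ range (q ^ (L + J)),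
          Φ h * Φ k * (if P h then (if h ≡ k [MOD q ^ (L + (J - j))] then
            2 * (N * ((q : ℝ) ^ j) ^ (-(1 / 2) : ℝ)) else 0) else 0) := by
        simp only [mul_add, sum_add_distrib]
        congr 1
        · rw [sq, sum_mul_sum, mul_sum]
          refine sum_congr rfl fun h _ => ?_
          rw [mul_sum]
          exact sum_congr rfl fun k _ => mul_comm _ _
        · simp only [mul_sum]
          rw [sum_congr rfl fun h _ => sum_comm, sum_comm]
    _ ≤ E * ((q : ℝ) ^ (η q f * (L + J : ℕ))) ^ 2 +
        ∑ _j ∈ range (J + 1), 2 * N * ((q : ℝ) ^ (c q f * (1 - σ))) ^ 2 := by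
        refine add_le_add ?_ (sum_le_sum hclass)
        gcongr
    _ = _ := by
        rw [sum_const, card_range, nsmul_eq_mul]
        push_cast
        ring

end Correlation

/-! ### The main estimate -/

lemma exists_filter_eq_Ico (s t : ℕ) {I : Set ℝ} (hI : I.OrdConnected)
    [DecidablePred fun n : ℕ => (n : ℝ) ∈ I] :
    ∃ a b : ℕ, b ≤ t ∧ (Ico s t).filter (fun n : ℕ => (n : ℝ) ∈ I) = Ico a b := by
  rcases ((Ico s t).filter (fun n : ℕ => (n : ℝ) ∈ I)).eq_empty_or_nonempty with h | h
  · exact ⟨0, 0, Nat.zero_le _, by rw [h]; simp⟩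
  · have hmax := mem_filter.1 (max'_mem _ h)
    have hmin := mem_filter.1 (min'_mem _ h)
    refine ⟨min' _ h, max' _ h + 1, (mem_Ico.1 hmax.1).2, ?_⟩
    ext n
    constructor
    · intro hn
      have h1 := min'_le _ n hn
      have h2 := le_max' _ n hn
      exact mem_Ico.2 ⟨h1, by omega⟩
    · intro hn
      have hn' := mem_Ico.1 hn
      have h1 := mem_Ico.1 hmax.1
      have h2 := mem_Ico.1 hmin.1
      refine mem_filter.2 ⟨mem_Ico.2 ⟨by omega, by omega⟩, hI.out hmin.2 hmax.2 ⟨?_, ?_⟩⟩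
      · exact_mod_cast hn'.1
      · exact_mod_cast (by omega : n ≤ _)

section Main

variable {q : ℕ} {f : ℕ → ℂ}

/-- The parameters are `J = ρ`, `σ = ν - 3ρ`, `l = 2μ + 3ρ` and `δ = q^{2ρ-ν}`, so that `δ q^{l+σ+ρ}
= q^l` exactly. The truncation error is about `q^{ν-ρ}`, the quasi-periodic term `q^{ν-ρ}` and the
Weyl term `q^{ν-ρ/2}`, the last two up to `q^{Λ/1000}`. In the exponent of the bound, `2C` absorbs
the constant in `μ ≤ ν/4 + C` and `1` the rounding of `ν/100`. -/
lemma norm_sum_corr_le (hf : IsStronglyQMultiplicative q f) (hq : q.Prime)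
    (hc : 0 < c q f) (hη : η q f ≤ 1 / 2000) {C : ℝ} (hC : 0 < C) {μ ν : ℕ} (hν : 1 ≤ ν)
    (hμ : (μ : ℝ) ≤ ν / 4 + C) {m : ℕ} (hmμ : m ≤ q ^ μ) (hm : ¬ q ∣ m) (a : ℕ) {b r : ℕ}
    (hb : b ≤ q ^ ν) (hr : 0 < r) (hrρ : r < q ^ (ν / 100)) :
    ‖∑ n ∈ Ico a (b - r), f (m ^ 2 * (n + r) ^ 2) * (starRingEnd ℂ) (f (m ^ 2 * n ^ 2))‖ ≤
      20 * ν * ((q : ℝ) ^ (ν : ℝ) * (q : ℝ) ^ (2 * C + 1 - 20 / 51 * c q f * ν)) := by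
  have hq0 := hq.pos
  have hq1 : (1 : ℝ) ≤ q := by exact_mod_cast hq.one_lt.le
  have hpos : (0 : ℝ) < q := by positivity
  have hq2 := ne_two_of_eta_lt_half hf (by linarith)
  have hcη := c_le_eta hf hq.one_lt hc
  set ρ := ν / 100 with hρ
  have hρν : 100 * ρ ≤ ν := by omega
  have hνρ : ν < 100 * ρ + 100 := by omega
  have hρνR : (100 : ℝ) * ρ ≤ ν := by exact_mod_cast hρν
  have hνρR : (ν : ℝ) < 100 * ρ + 100 := by exact_mod_cast hνρ
  have hν1 : (1 : ℝ) ≤ ν := by exact_mod_cast hν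
  set σ := ν - 3 * ρ with hσ
  have hσR : (σ : ℝ) = ν - 3 * ρ := by
    rw [hσ, Nat.cast_sub (by omega)]
    push_cast
    ring
  set l := 2 * μ + 3 * ρ with hl
  set Λ := l + σ + ρ + ρ with hΛ
  have hΛν : Λ = 2 * μ + ν + 2 * ρ := by omega
  have hΛR : (Λ : ℝ) = 2 * μ + ν + 2 * ρ := by exact_mod_cast hΛν
  set W := (q : ℝ) ^ (2 * C + 1 - 20 / 51 * c q f * ν) with hW
  set N := (q : ℝ) ^ (ν : ℝ) with hN
  have hcν : c q f * ν ≤ 1 / 2000 * ν := by gcongr; linarith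
  have hηΛ : η q f * Λ ≤ 1 / 2000 * Λ := by gcongr
  have hcρ : c q f * ρ ≤ 1 / 100 * (c q f * ν) := by nlinarith
  have hcν0 : 0 < c q f * ν := by positivity
  have hW0 : 0 < W := by positivity
  have hN0 : 0 < N := by positivity
  have hpow : ∀ {x y : ℝ}, x ≤ y → (q : ℝ) ^ x ≤ (q : ℝ) ^ y := fun h =>
    Real.rpow_le_rpow_of_exponent_le hq1 h
  have hδl : (q : ℝ) ^ (2 * ρ - ν : ℝ) * q ^ (l + σ + ρ) ≤ q ^ l := by
    rw [← Real.rpow_natCast, ← Real.rpow_natCast, ← Real.rpow_add hpos]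
    apply hpow
    push_cast
    rw [hσR]
    linarith
  have hmain := norm_sum_corr_mod_le_of_params hf hq hq2 hc (by linarith) hm l σ ρ a
    ((Nat.sub_le b r).trans hb) (Nat.pow_le_pow_right hq0 (by omega : ν ≤ Λ)) hr hrρ
    (by positivity : (0 : ℝ) < (q : ℝ) ^ (2 * ρ - ν : ℝ)) hδl
  have htrunc := norm_sum_sub_sum_mod_le hf hq0 Λ m a (r := r) hb
  have hsub := norm_le_norm_add_norm_sub'
    (∑ n ∈ Ico a (b - r), f (m ^ 2 * (n + r) ^ 2) * (starRingEnd ℂ) (f (m ^ 2 * n ^ 2)))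
    (∑ n ∈ Ico a (b - r), f (m ^ 2 * (n + r) ^ 2 % q ^ Λ) *
      (starRingEnd ℂ) (f (m ^ 2 * n ^ 2 % q ^ Λ)))
  have hNpow : (((q ^ ν : ℕ) : ℝ)) = N := by
    rw [hN, Real.rpow_natCast]
    push_cast
    rfl
  rw [hNpow] at hmain htrunc
  have h1 : r * (m ^ 2 * N ^ 2 / (q : ℝ) ^ Λ) ≤ N * W := by
    have hrR : (r : ℝ) ≤ (q : ℝ) ^ (ρ : ℝ) := by
      rw [Real.rpow_natCast]
      exact_mod_cast hrρ.le
    have hmR : (m : ℝ) ≤ (q : ℝ) ^ (μ : ℝ) := by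
      rw [Real.rpow_natCast]
      exact_mod_cast hmμ
    calc _ ≤ (q : ℝ) ^ (ρ : ℝ) * (((q : ℝ) ^ (μ : ℝ)) ^ 2 * N ^ 2 / (q : ℝ) ^ Λ) := by gcongr
      _ = N * (q : ℝ) ^ (-ρ : ℝ) := by
        rw [hN, ← Real.rpow_natCast _ Λ, ← Real.rpow_mul_natCast hpos.le,
          ← Real.rpow_mul_natCast hpos.le, ← Real.rpow_add hpos, ← Real.rpow_sub hpos,
          ← Real.rpow_add hpos, ← Real.rpow_add hpos, hΛR]
        congr 1
        push_cast
        ring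
      _ ≤ _ := by
        gcongr
        apply hpow
        linarith
  have hsq : ((q : ℝ) ^ (η q f * Λ)) ^ 2 ≤ (q : ℝ) ^ ((Λ : ℝ) / 1000) := by
    rw [← Real.rpow_mul_natCast hpos.le]
    apply hpow
    push_cast
    linarith
  have h2 : ((q : ℝ) ^ Λ) ^ (11 / 20 : ℝ) * (q : ℝ) ^ ((Λ : ℝ) / 1000) ≤ N * W := by
    rw [hN, hW, ← Real.rpow_natCast, ← Real.rpow_mul hpos.le, ← Real.rpow_add hpos,
      ← Real.rpow_add hpos]
    apply hpow
    linarith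
  have h3 : N * ((q : ℝ) ^ ρ) ^ (-(1 / 2) : ℝ) * (q : ℝ) ^ ((Λ : ℝ) / 1000) ≤ N * W := by
    rw [hN, hW, ← Real.rpow_natCast, ← Real.rpow_mul hpos.le, ← Real.rpow_add hpos,
      ← Real.rpow_add hpos, ← Real.rpow_add hpos]
    apply hpow
    linarith
  have h4 : (q : ℝ) ^ ρ / (q : ℝ) ^ (2 * ρ - ν : ℝ) * (q : ℝ) ^ ((Λ : ℝ) / 1000) ≤ N * W := by
    rw [hN, hW, ← Real.rpow_natCast, ← Real.rpow_sub hpos, ← Real.rpow_add hpos,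
      ← Real.rpow_add hpos]
    apply hpow
    linarith
  have h5 : ((q : ℝ) ^ (c q f * (1 - σ))) ^ 2 ≤ W := by
    rw [hW, ← Real.rpow_mul_natCast hpos.le]
    apply hpow
    rw [hσR]
    push_cast
    linarith
  have h6 : (10 * ((q : ℝ) ^ Λ) ^ (11 / 20 : ℝ) + 2 * (N * ((q : ℝ) ^ ρ) ^ (-(1 / 2) : ℝ)) +
      2 * q ^ ρ / (q : ℝ) ^ (2 * ρ - ν : ℝ)) * ((q : ℝ) ^ (η q f * Λ)) ^ 2 ≤ 14 * (N * W) := by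
    refine (mul_le_mul_of_nonneg_left hsq (by positivity)).trans ?_
    calc _ = 10 * (((q : ℝ) ^ Λ) ^ (11 / 20 : ℝ) * (q : ℝ) ^ ((Λ : ℝ) / 1000)) +
          2 * (N * ((q : ℝ) ^ ρ) ^ (-(1 / 2) : ℝ) * (q : ℝ) ^ ((Λ : ℝ) / 1000)) +
          2 * ((q : ℝ) ^ ρ / (q : ℝ) ^ (2 * ρ - ν : ℝ) * (q : ℝ) ^ ((Λ : ℝ) / 1000)) := by ring
      _ ≤ _ := by linarith
  have h7 : 2 * N * (ρ + 1) * ((q : ℝ) ^ (c q f * (1 - σ))) ^ 2 ≤ 2 * N * (ρ + 1) * W := by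
    gcongr
  have h8 : (18 + 2 * (ρ : ℝ)) * (N * W) ≤ 20 * ν * (N * W) := by
    gcongr
    linarith
  have hNW : 0 < N * W := by positivity
  calc _ ≤ _ := hsub
    _ ≤ (14 * (N * W) + 2 * N * (ρ + 1) * W) + 2 * (N * W) := by
      refine add_le_add (hmain.trans (add_le_add h6 h7)) (htrunc.trans ?_)
      gcongr
    _ ≤ (18 + 2 * (ρ : ℝ)) * (N * W) := by linarith
    _ ≤ _ := h8

lemma norm_sum_le_of_not_dvd (hf : IsStronglyQMultiplicative q f) (hq : q.Prime)
    (hc : 0 < c q f) (hη : η q f ≤ 1 / 2000) {C : ℝ} (hC : 0 < C) {μ ν : ℕ} (hν : 1 ≤ ν)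
    (hμ : (μ : ℝ) ≤ ν / 4 + C) {m : ℕ} (hmμ : m ≤ q ^ μ) (hm : ¬ q ∣ m) (a : ℕ) {b : ℕ}
    (hb : b ≤ q ^ ν) (β : ℝ) :
    ‖∑ n ∈ Ico a b, f (m ^ 2 * n ^ 2) * e (β * n)‖ ≤
      10 * (q : ℝ) ^ (C + 1 / 2) * (ν : ℝ) ^ (1 / 2 : ℝ) *
        ((q : ℝ) ^ (ν : ℝ) * (q : ℝ) ^ (-(10 / 51 : ℝ) * c q f * ν)) := by
  have hq0 := hq.pos
  have hq1 : (1 : ℝ) ≤ q := by exact_mod_cast hq.one_lt.le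
  have hpos : (0 : ℝ) < q := by positivity
  have hcη := c_le_eta hf hq.one_lt hc
  have hν1 : (1 : ℝ) ≤ ν := by exact_mod_cast hν
  set ρ := ν / 100 with hρ
  have hνρR : (ν : ℝ) < 100 * ρ + 100 := by exact_mod_cast (by omega : ν < 100 * ρ + 100)
  set z : ℕ → ℂ := fun n => f (m ^ 2 * n ^ 2) * e (β * n) with hz
  have hz1 : ∀ n, ‖z n‖ ≤ 1 := fun n => by simp [hz, hf.norm_eq_one, norm_e]
  have hcorr : ∀ d ∈ Ico 1 (q ^ ρ),
      ‖∑ n ∈ Ico a (b - d), z (n + d) * (starRingEnd ℂ) (z n)‖ ≤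
      20 * ν * ((q : ℝ) ^ (ν : ℝ) * (q : ℝ) ^ (2 * C + 1 - 20 / 51 * c q f * ν)) := by
    intro d hd
    have hd' := mem_Ico.1 hd
    refine le_trans (le_of_eq ?_) (norm_sum_corr_le hf hq hc hη hC hν hμ hmμ hm a hb hd'.1 hd'.2)
    have h1 : ∑ n ∈ Ico a (b - d), z (n + d) * (starRingEnd ℂ) (z n) = e (β * d) *
        ∑ n ∈ Ico a (b - d), f (m ^ 2 * (n + d) ^ 2) * (starRingEnd ℂ) (f (m ^ 2 * n ^ 2)) := by
      rw [mul_sum]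
      refine sum_congr rfl fun n _ => ?_
      have h2 : e (β * (n + d : ℕ)) * e (-(β * n)) = e (β * d) := by
        rw [← e_add]
        congr 1
        push_cast
        ring
      simp only [hz, map_mul, conj_e]
      rw [mul_mul_mul_comm, h2, mul_comm]
    rw [h1, norm_mul, norm_e, one_mul]
  set W := (q : ℝ) ^ (2 * C + 1 - 20 / 51 * c q f * ν) with hW
  set N := (q : ℝ) ^ (ν : ℝ) with hN
  set R := (q : ℝ) ^ (ρ : ℝ) with hR
  have hW0 : 0 < W := by positivity
  have hN0 : 0 < N := by positivity
  have hR0 : 0 < R := by positivity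
  have hvdc := van_der_corput hz1 a hb (by positivity : 0 < q ^ ρ)
  have hNpow : (((q ^ ν : ℕ) : ℝ)) = N := by
    rw [hN, Real.rpow_natCast]
    push_cast
    rfl
  have hRpow : (((q ^ ρ : ℕ) : ℝ)) = R := by
    rw [hR, Real.rpow_natCast]
    push_cast
    rfl
  rw [hNpow, hRpow] at hvdc
  have hsum : ∑ d ∈ Ico 1 (q ^ ρ), ‖∑ n ∈ Ico a (b - d), z (n + d) * (starRingEnd ℂ) (z n)‖ ≤
      R * (20 * ν * (N * W)) := by
    refine (sum_le_sum hcorr).trans ?_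
    rw [sum_const, Nat.card_Ico, nsmul_eq_mul, ← hRpow]
    gcongr
    exact Nat.sub_le _ _
  have hRN : R ≤ N := by
    apply Real.rpow_le_rpow_of_exponent_le hq1
    exact_mod_cast (by omega : ρ ≤ ν)
  -- The diagonal term of van der Corput's inequality saves only `1/R`, which must not exceed `W`.
  have hRW : 1 ≤ R * W := by
    rw [hR, hW, ← Real.rpow_add hpos]
    apply Real.one_le_rpow hq1
    have : c q f * ν ≤ 1 / 2000 * ν := by gcongr; linarith
    linarith
  set T := ‖∑ n ∈ Ico a b, z n‖ with hT
  -- The computation gives `2(1 + 40) = 82`, rounded up to the square `100`.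
  have hsq : T ^ 2 ≤ 100 * ν * (N ^ 2 * W) := by
    refine le_of_mul_le_mul_left ?_ hR0
    calc R * T ^ 2 ≤ (N + R) * (N + 2 * ∑ d ∈ Ico 1 (q ^ ρ),
          ‖∑ n ∈ Ico a (b - d), z (n + d) * (starRingEnd ℂ) (z n)‖) := hvdc
      _ ≤ (N + N) * (N * (ν * (R * W)) + 2 * (R * (20 * ν * (N * W)))) := by
        gcongr
        exact le_mul_of_one_le_right hN0.le (one_le_mul_of_one_le_of_one_le hν1 hRW)
      _ = R * (82 * ν * (N ^ 2 * W)) := by ring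
      _ ≤ _ := by
        gcongr
        norm_num
  refine le_of_sq_le_sq (hsq.trans (le_of_eq ?_)) (by positivity)
  have e1 : ((ν : ℝ) ^ (1 / 2 : ℝ)) ^ 2 = ν := by
    rw [← Real.rpow_mul_natCast (by positivity)]
    norm_num
  have e2 : ((q : ℝ) ^ (C + 1 / 2)) ^ 2 * ((q : ℝ) ^ (-(10 / 51 : ℝ) * c q f * ν)) ^ 2 = W := by
    rw [hW, ← Real.rpow_mul_natCast hpos.le, ← Real.rpow_mul_natCast hpos.le,
      ← Real.rpow_add hpos]
    congr 1
    push_cast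
    ring
  rw [mul_pow, mul_pow, mul_pow, mul_pow, e1, ← e2]
  ring

/-- If `m = q^v M`, then `m²n²` is `M²n²` followed by `2v` zero digits in base `q`, which `f` does
not see. -/
lemma norm_sum_le_of_pos (hf : IsStronglyQMultiplicative q f) (hq : q.Prime)
    (hc : 0 < c q f) (hη : η q f ≤ 1 / 2000) {C : ℝ} (hC : 0 < C) {μ ν : ℕ} (hν : 1 ≤ ν)
    (hμ : (μ : ℝ) ≤ ν / 4 + C) {m : ℕ} (hmμ : m ≤ q ^ μ) (hm : 0 < m) (a : ℕ) {b : ℕ}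
    (hb : b ≤ q ^ ν) (β : ℝ) :
    ‖∑ n ∈ Ico a b, f (m ^ 2 * n ^ 2) * e (β * n)‖ ≤
      10 * (q : ℝ) ^ (C + 1 / 2) * (ν : ℝ) ^ (1 / 2 : ℝ) *
        ((q : ℝ) ^ (ν : ℝ) * (q : ℝ) ^ (-(10 / 51 : ℝ) * c q f * ν)) := by
  obtain ⟨v, M, hM, rfl⟩ := Nat.exists_eq_pow_mul_and_not_dvd hm.ne' q hq.ne_one
  have hMμ : M ≤ q ^ μ := (Nat.le_mul_of_pos_left M (by have := hq.pos; positivity)).trans hmμ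
  refine le_trans (le_of_eq ?_) (norm_sum_le_of_not_dvd hf hq hc hη hC hν hμ hMμ hM a hb β)
  congr 1
  refine sum_congr rfl fun n _ => ?_
  rw [← hf.map_mul_pow hq.pos (2 * v) (M ^ 2 * n ^ 2)]
  congr 2
  ring

end Main

end SquareDigits

theorem mainTheorem5 (q : ℕ) (hq : q.Prime) (f : ℕ → ℂ)
    (hf : SquareDigits.IsProper q f) (hη : SquareDigits.η q f ≤ 1 / 2000)
    (C : ℝ) (hC : 0 < C) :
    ∃ K : ℝ, 0 < K ∧ ∀ (μ ν : ℕ), (μ : ℝ) ≤ (ν : ℝ) / 4 + C →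
      ∀ (θ : ℝ) (I : ℕ → Set ℝ),
        (∀ m ∈ Finset.Ico (q ^ (μ - 1)) (q ^ μ),
          (I m).OrdConnected ∧ I m ⊆ Set.Ico ((q : ℝ) ^ (ν - 1)) ((q : ℝ) ^ ν)) →
        (q : ℝ) ^ (-(μ : ℝ) - (ν : ℝ)) * |SquareDigits.typeISum q f μ ν I θ| ≤
          K * (ν : ℝ) ^ (1 / 2 : ℝ) *
            (q : ℝ) ^ (-(10 / 51 : ℝ) * SquareDigits.c q f * (ν : ℝ)) := by
  classical
  have hf' := hf.toIsStronglyQMultiplicative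
  have hq0 := hq.pos
  have hq1 : (1 : ℝ) ≤ q := by exact_mod_cast hq.one_lt.le
  have hpos : (0 : ℝ) < q := by positivity
  refine ⟨10 * (q : ℝ) ^ (C + 1 / 2), by positivity, fun μ ν hμ θ I hI => ?_⟩
  set B := 10 * (q : ℝ) ^ (C + 1 / 2) * (ν : ℝ) ^ (1 / 2 : ℝ) *
    (q : ℝ) ^ (-(10 / 51 : ℝ) * SquareDigits.c q f * (ν : ℝ)) with hB
  have hB0 : 0 ≤ B := by positivity
  have hinner : ∀ m ∈ Finset.Ico (q ^ (μ - 1)) (q ^ μ),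
      ‖∑ n ∈ (Finset.Ico (q ^ (ν - 1)) (q ^ ν)).filter (fun n : ℕ => (n : ℝ) ∈ I m),
        f (m ^ 2 * n ^ 2) * SquareDigits.e (θ * m * n)‖ ≤ (q : ℝ) ^ (ν : ℝ) * B := by
    intro m hm
    have hm' := Finset.mem_Ico.1 hm
    have hm0 : 0 < m := lt_of_lt_of_le (by positivity) hm'.1
    -- For `ν = 0` the truncated exponent makes the range of `n` empty.
    rcases Nat.eq_zero_or_pos ν with rfl | hν
    · simp
      positivity
    obtain ⟨a, b, hb, hab⟩ := SquareDigits.exists_filter_eq_Ico (q ^ (ν - 1)) (q ^ ν) (hI m hm).1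
    rcases lt_or_ge 0 (SquareDigits.c q f) with hc | hc
    · rw [hab]
      refine (SquareDigits.norm_sum_le_of_pos hf' hq hc hη hC hν hμ hm'.2.le hm0 a hb
        (θ * m)).trans (le_of_eq ?_)
      rw [hB]
      ring
    -- If `c ≤ 0` the claimed factor is at least 1, and counting terms suffices.
    · have hB1 : 1 ≤ B := by
        have hν1 : (1 : ℝ) ≤ ν := by exact_mod_cast hν
        have h1 : 1 ≤ 10 * (q : ℝ) ^ (C + 1 / 2) := by
          have := Real.one_le_rpow hq1 (by positivity : 0 ≤ C + 1 / 2)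
          linarith
        have h2 : 1 ≤ (ν : ℝ) ^ (1 / 2 : ℝ) := Real.one_le_rpow hν1 (by norm_num)
        have h3 : 1 ≤ (q : ℝ) ^ (-(10 / 51 : ℝ) * SquareDigits.c q f * (ν : ℝ)) := by
          apply Real.one_le_rpow hq1
          nlinarith
        exact one_le_mul_of_one_le_of_one_le (one_le_mul_of_one_le_of_one_le h1 h2) h3
      refine le_trans ?_ (le_mul_of_one_le_right (by positivity) hB1)
      refine (norm_sum_le _ _).trans ?_
      simp only [norm_mul, hf'.norm_eq_one, SquareDigits.norm_e, mul_one, Finset.sum_const,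
        nsmul_eq_mul, hab, Nat.card_Ico]
      rw [Real.rpow_natCast]
      exact_mod_cast (Nat.sub_le b a).trans hb
  have hsum : SquareDigits.typeISum q f μ ν I θ ≤
      (q : ℝ) ^ (μ : ℝ) * ((q : ℝ) ^ (ν : ℝ) * B) := by
    rw [SquareDigits.typeISum]
    refine le_trans (Finset.sum_le_sum fun m hm => le_trans (le_of_eq ?_) (hinner m hm)) ?_
    · congr!
    · rw [Finset.sum_const, Nat.card_Ico, nsmul_eq_mul, Real.rpow_natCast _ μ]
      gcongr
      exact_mod_cast Nat.sub_le _ _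
  have hnonneg : 0 ≤ SquareDigits.typeISum q f μ ν I θ :=
    Finset.sum_nonneg fun _ _ => norm_nonneg _
  rw [abs_of_nonneg hnonneg]
  calc _ ≤ (q : ℝ) ^ (-(μ : ℝ) - (ν : ℝ)) * ((q : ℝ) ^ (μ : ℝ) * ((q : ℝ) ^ (ν : ℝ) * B)) := by
        gcongr
    _ = B := by
        rw [← mul_assoc, ← mul_assoc, ← Real.rpow_add hpos, ← Real.rpow_add hpos]
        ring_nf
        simp
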